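/- Conventions. An instance of \(\mathrm{ARM}(3)\) (affine rank minimization with rank bound \(3\)) consists of natural numbers \(m,n,q\ge 0\), rational matrices \(A_1,\dots,A_q\in\mathbb{Q}^{m\times n}\) and rational numbers \(b_1,\dots,b_q\in\mathbb{Q}\); it is written with \(m,n,q\) in binary, followed by all entries of all \(A_\ell\) and all \(b_\ell\) as reduced fractions with binary numerators and denominators. It is a yes-instance if and only if there is \(X\in\mathbb{R}^{m\times n}\) with \(\langle A_\ell,X\rangle=\sum_{i,j}(A_\ell)_{ij}X_{ij}=b_\ell\) for all \(\ell\in\{1,\dots,q\}\) and \(\operatorname{rank}(X)\le 3\). An instance of \(\mathrm{ETR}\) is a sentence \(\exists x\in\mathbb{R}^N:\varphi(x)\), where \(\varphi\) is a Boolean combination (with \(\wedge,\vee,\neg\)) of atoms \(p=0\), \(p\ne0\), \(p\ge0\), \(p>0\) with \(p\in\mathbb{Z}[x_1,\dots,x_N]\); polynomials are written in sparse form, as lists of terms, each given by its integer coefficient and its exponent vector in binary. It is a yes-instance if and only if the sentence is true. The class \(\exists\mathbb{R}\) consists of the decision problems that are polynomial-time many-one reducible to \(\mathrm{ETR}\).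 **Theorem.** \(\mathrm{ARM}(3)\in\exists\mathbb{R}\). Moreover, there is a polynomial-time many-one reduction \(f\) from \(\mathrm{ARM}(3)\) to \(\mathrm{ETR}\) which maps every instance with \(q\ge 1\) to a sentence \(\exists X\in\mathbb{R}^{m\times n}:\varphi(X)\) in the \(mn\) entries of \(X\), where \(\varphi\) is a conjunction (of length polynomial in the length of the instance, since \(f\) is computable in polynomial time) of the following polynomial equalities with integer coefficients: 1. for each \(\ell\in\{1,\dots,q\}\), the affine equality \(d_\ell\,(\langle A_\ell,X\rangle-b_\ell)=0\), where \(d_\ell\) is a positive integer such that \(d_\ell(\langle A_\ell,X\rangle-b_\ell)\) has integer coefficients; 2. for all \(I\subseteq\{1,\dots,m\}\) and \(J\subseteq\{1,\dots,n\}\) with \(|I|=|J|=4\), the equality \(\det(X[I,J])=0\) of degree \(4\), where \(X[I,J]\) is the submatrix of \(X\) with rows \(I\) and columns \(J\), and its determinant is written as a sum of \(24\) terms. -/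

import Mathlib

/-! ## Symbols, and prefix codes for the elementary data -/

/-- The finite alphabet over which all instances are written. -/
inductive Symb
  | bit (b : Bool)
  | endNum
  | item
  | endList
  | var
  | eqZero
  | neZero
  | geZero
  | gtZero
  | neg
  | and
  | or
  deriving DecidableEq, Fintype

/-- No code word is a proper prefix of another one, and different objects have different codes. -/
def IsPrefixCode {α : Type} (e : α → List Symb) : Prop :=
  ∀ (a b : α) (s t : List Symb), e a ++ s = e b ++ t → a = b ∧ s = t

theorem IsPrefixCode.injective {α : Type} {e : α → List Symb} (he : IsPrefixCode e) :
    Function.Injective e := fun a b h => (he a b [] [] (by rw [h])).1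

/-- A natural number in binary, least significant bit first, followed by an end marker. -/
def encNat (k : ℕ) : List Symb := (Computability.encodeNat k).map Symb.bit ++ [Symb.endNum]

/-- An integer: a sign bit, then the absolute value in binary. -/
def encInt (z : ℤ) : List Symb := Symb.bit (decide (z < 0)) :: encNat z.natAbs

/-- A rational number in reduced form: the numerator, then the denominator. -/
def encRat (r : ℚ) : List Symb := encInt r.num ++ encNat r.den

/-- A list: every item is preceded by an item marker, the list is closed by an end marker. -/
def encList {α : Type} (e : α → List Symb) : List α → List Symb
  | [] => [Symb.endList]
  | a :: l => Symb.item :: (e a ++ encList e l)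

/-- A vector, written as the list of its entries. -/
def encVec {α : Type} (e : α → List Symb) {N : ℕ} (v : Fin N → α) : List Symb :=
  encList e (List.ofFn v)

theorem isPrefixCode_encNat : IsPrefixCode encNat := by
  have key : ∀ (u v : List Bool) (s t : List Symb),
      u.map Symb.bit ++ [Symb.endNum] ++ s = v.map Symb.bit ++ [Symb.endNum] ++ t →
        u = v ∧ s = t := by
    intro u
    induction u with
    | nil =>
      intro v s t h
      cases v with
      | nil => simpa using h
      | cons b v => simp at h
    | cons a u ih =>
      intro v s t h
      cases v with
      | nil => simp at h
      | cons b v =>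
        simp only [List.map_cons, List.cons_append, List.cons.injEq, Symb.bit.injEq] at h
        obtain ⟨h1, h2⟩ := ih v s t h.2
        exact ⟨by rw [h.1, h1], h2⟩
  intro a b s t h
  obtain ⟨h1, h2⟩ := key _ _ s t h
  refine ⟨?_, h2⟩
  rw [← Computability.decode_encodeNat a, h1, Computability.decode_encodeNat]

theorem isPrefixCode_encInt : IsPrefixCode encInt := by
  intro a b s t h
  simp only [encInt, List.cons_append, List.cons.injEq, Symb.bit.injEq, decide_eq_decide] at h
  obtain ⟨h1, h2⟩ := isPrefixCode_encNat _ _ s t h.2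
  exact ⟨by omega, h2⟩

theorem isPrefixCode_encRat : IsPrefixCode encRat := by
  intro a b s t h
  simp only [encRat, List.append_assoc] at h
  obtain ⟨h1, h2⟩ := isPrefixCode_encInt _ _ _ _ h
  obtain ⟨h3, h4⟩ := isPrefixCode_encNat _ _ s t h2
  exact ⟨Rat.ext h1 h3, h4⟩

theorem IsPrefixCode.encList {α : Type} {e : α → List Symb} (he : IsPrefixCode e) :
    IsPrefixCode (encList e) := by
  intro u
  induction u with
  | nil =>
    intro v s t h
    cases v with
    | nil => simpa [_root_.encList] using h
    | cons b v => simp [_root_.encList] at h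
  | cons a u ih =>
    intro v s t h
    cases v with
    | nil => simp [_root_.encList] at h
    | cons b v =>
      simp only [_root_.encList, List.cons_append, List.append_assoc, List.cons.injEq,
        true_and] at h
      obtain ⟨h1, h2⟩ := he _ _ _ _ h
      obtain ⟨h3, h4⟩ := ih v s t h2
      exact ⟨by rw [h1, h3], h4⟩

theorem IsPrefixCode.encVec {α : Type} {e : α → List Symb} (he : IsPrefixCode e) (N : ℕ) :
    IsPrefixCode (encVec e (N := N)) := by
  intro u v s t h
  obtain ⟨h1, h2⟩ := he.encList _ _ s t h
  exact ⟨List.ofFn_injective h1, h2⟩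

/-! ## Decision problems and polynomial-time many-one reductions -/

/-- A decision problem: instances, written injectively as words over a finite alphabet, and the
set of yes-instances. -/
structure DecisionProblem where
  Inst : Type
  Alphabet : Type
  [finiteAlphabet : Finite Alphabet]
  encode : Inst → List Alphabet
  encode_injective : Function.Injective encode
  yes : Set Inst

/-- `f` is computed by a (multi-stack) Turing machine whose number of steps is bounded by a
polynomial in the length of the encoding of the input. -/
def PolyTimeComputable (P Q : DecisionProblem) (f : P.Inst → Q.Inst) : Prop :=
  Nonempty (Turing.TM2ComputableInPolyTime P.encode Q.encode f)

/-- `f` is a polynomial-time many-one reduction from `P` to `Q`. -/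
def IsPolyTimeReduction (P Q : DecisionProblem) (f : P.Inst → Q.Inst) : Prop :=
  PolyTimeComputable P Q f ∧ ∀ I : P.Inst, I ∈ P.yes ↔ f I ∈ Q.yes

/-! ## The existential theory of the reals -/

/-- An integer polynomial in sparse form: a list of terms, each of them an integer coefficient
with the exponent vector of a monomial. -/
abbrev SparsePoly (N : ℕ) : Type := List (ℤ × (Fin N → ℕ))

/-- The polynomial denoted by a sparse form. -/
noncomputable def SparsePoly.toMvPolynomial {N : ℕ} (p : SparsePoly N) :
    MvPolynomial (Fin N) ℤ :=
  (p.map fun c => MvPolynomial.monomial (Finsupp.equivFunOnFinite.symm c.2) c.1).sum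

/-- Quantifier-free formulas: Boolean combinations of the atoms `p = 0`, `p ≠ 0`, `p ≥ 0` and
`p > 0`. -/
inductive QFFormula (N : ℕ) : Type
  | eqZero (p : SparsePoly N)
  | neZero (p : SparsePoly N)
  | geZero (p : SparsePoly N)
  | gtZero (p : SparsePoly N)
  | neg (φ : QFFormula N)
  | and (φ ψ : QFFormula N)
  | or (φ ψ : QFFormula N)

/-- Truth of a quantifier-free formula at a real point. -/
def QFFormula.Holds {N : ℕ} (x : Fin N → ℝ) : QFFormula N → Prop
  | eqZero p => MvPolynomial.aeval x p.toMvPolynomial = 0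
  | neZero p => MvPolynomial.aeval x p.toMvPolynomial ≠ 0
  | geZero p => 0 ≤ MvPolynomial.aeval x p.toMvPolynomial
  | gtZero p => 0 < MvPolynomial.aeval x p.toMvPolynomial
  | neg φ => ¬ φ.Holds x
  | and φ ψ => φ.Holds x ∧ ψ.Holds x
  | or φ ψ => φ.Holds x ∨ ψ.Holds x

/-- The conjunction of the equalities `p = 0` for `p` in a list; it is closed by `0 = 0`, so that
the empty conjunction is true. -/
def QFFormula.allZero {N : ℕ} : List (SparsePoly N) → QFFormula N
  | [] => eqZero []
  | p :: l => and (eqZero p) (allZero l)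

/-- A sentence `∃ x ∈ ℝ^N, φ(x)`. -/
structure ETRSentence where
  N : ℕ
  φ : QFFormula N

/-- Truth of an existential sentence over the reals. -/
def ETRSentence.IsTrue (S : ETRSentence) : Prop := ∃ x : Fin S.N → ℝ, S.φ.Holds x

/-- Sparse form: the list of the terms, with coefficients and exponents in binary. -/
def encPoly {N : ℕ} : SparsePoly N → List Symb :=
  encList fun c => encInt c.1 ++ encVec encNat c.2

/-- Formulas in prefix notation. -/
def encFormula {N : ℕ} : QFFormula N → List Symb
  | .eqZero p => Symb.eqZero :: encPoly p
  | .neZero p => Symb.neZero :: encPoly p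
  | .geZero p => Symb.geZero :: encPoly p
  | .gtZero p => Symb.gtZero :: encPoly p
  | .neg φ => Symb.neg :: encFormula φ
  | .and φ ψ => Symb.and :: (encFormula φ ++ encFormula ψ)
  | .or φ ψ => Symb.or :: (encFormula φ ++ encFormula ψ)

/-- A sentence: the quantifier prefix, with one symbol for each quantified variable, then the
quantifier-free formula. -/
def encSentence (S : ETRSentence) : List Symb :=
  List.replicate S.N Symb.var ++ Symb.endList :: encFormula S.φ

theorem isPrefixCode_encPoly (N : ℕ) : IsPrefixCode (encPoly (N := N)) := by
  refine IsPrefixCode.encList ?_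
  intro a b s t h
  simp only [List.append_assoc] at h
  obtain ⟨h1, h2⟩ := isPrefixCode_encInt _ _ _ _ h
  obtain ⟨h3, h4⟩ := isPrefixCode_encNat.encVec N _ _ _ _ h2
  exact ⟨Prod.ext h1 h3, h4⟩

theorem isPrefixCode_encFormula (N : ℕ) : IsPrefixCode (encFormula (N := N)) := by
  intro φ
  induction φ with
  | eqZero p | neZero p | geZero p | gtZero p =>
    intro ψ s t h
    cases ψ <;> simp [encFormula] at h
    obtain ⟨h1, h2⟩ := isPrefixCode_encPoly N _ _ _ _ h
    exact ⟨by rw [h1], h2⟩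
  | neg φ ih =>
    intro ψ s t h
    cases ψ <;> simp [encFormula] at h
    obtain ⟨h1, h2⟩ := ih _ _ _ h
    exact ⟨by rw [h1], h2⟩
  | and φ φ' ih ih' | or φ φ' ih ih' =>
    intro ψ s t h
    cases ψ <;> simp [encFormula] at h
    obtain ⟨h1, h2⟩ := ih _ _ _ h
    obtain ⟨h3, h4⟩ := ih' _ _ _ h2
    exact ⟨by rw [h1, h3], h4⟩

theorem encSentence_injective : Function.Injective encSentence := by
  have key : ∀ (M N : ℕ) (s t : List Symb),
      List.replicate M Symb.var ++ Symb.endList :: s =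
        List.replicate N Symb.var ++ Symb.endList :: t → M = N ∧ s = t := by
    intro M
    induction M with
    | zero =>
      intro N s t h
      cases N with
      | zero => simpa using h
      | succ N => simp [List.replicate_succ] at h
    | succ M ih =>
      intro N s t h
      cases N with
      | zero => simp [List.replicate_succ] at h
      | succ N =>
        simp only [List.replicate_succ, List.cons_append, List.cons.injEq, true_and] at h
        obtain ⟨h1, h2⟩ := ih N s t h
        exact ⟨by rw [h1], h2⟩
  rintro ⟨M, φ⟩ ⟨N, ψ⟩ h
  obtain ⟨h1, h2⟩ := key M N _ _ h
  subst h1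
  exact congrArg (ETRSentence.mk M) ((isPrefixCode_encFormula M).injective h2)

/-- The decision problem ETR. -/
def ETR : DecisionProblem where
  Inst := ETRSentence
  Alphabet := Symb
  encode := encSentence
  encode_injective := encSentence_injective
  yes := {S | S.IsTrue}

/-- The class `∃ℝ`: the problems that are polynomial-time many-one reducible to ETR. -/
def InExistsR (P : DecisionProblem) : Prop :=
  ∃ f : P.Inst → ETR.Inst, IsPolyTimeReduction P ETR f

/-! ## Affine rank minimization -/

/-- An instance: rational `m × n` matrices `A 0, …, A (q - 1)` and rational numbers
`b 0, …, b (q - 1)`. -/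
structure ARMInstance where
  m : ℕ
  n : ℕ
  q : ℕ
  A : Fin q → Matrix (Fin m) (Fin n) ℚ
  b : Fin q → ℚ

/-- `X` satisfies all constraints `⟨A ℓ, X⟩ = b ℓ` and has rank at most `k`. -/
def ARMInstance.IsSolution (I : ARMInstance) (k : ℕ) (X : Matrix (Fin I.m) (Fin I.n) ℝ) : Prop :=
  (∀ l, ∑ i, ∑ j, (I.A l i j : ℝ) * X i j = (I.b l : ℝ)) ∧ X.rank ≤ k

/-- An instance is written as `m`, `n`, `q` in binary, then the matrices row by row, then the
right-hand sides; all rational numbers are in reduced form. -/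
def encARM (I : ARMInstance) : List Symb :=
  encNat I.m ++ encNat I.n ++ encNat I.q ++
    encVec (fun M : Fin I.m → Fin I.n → ℚ => encVec (encVec encRat) M) I.A ++
    encVec encRat I.b

theorem encARM_injective : Function.Injective encARM := by
  rintro ⟨m, n, q, A, b⟩ ⟨m', n', q', A', b'⟩ h
  simp only [encARM, List.append_assoc] at h
  obtain ⟨rfl, h⟩ := isPrefixCode_encNat _ _ _ _ h
  obtain ⟨rfl, h⟩ := isPrefixCode_encNat _ _ _ _ h
  obtain ⟨rfl, h⟩ := isPrefixCode_encNat _ _ _ _ h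
  obtain ⟨h1, h⟩ := (((isPrefixCode_encRat.encVec n).encVec m).encVec q) A A' _ _ h
  have h2 := (isPrefixCode_encRat.encVec q).injective h
  subst h1 h2
  rfl

/-- The decision problem `ARM(k)`. -/
def ARM (k : ℕ) : DecisionProblem where
  Inst := ARMInstance
  Alphabet := Symb
  encode := encARM
  encode_injective := encARM_injective
  yes := {I | ∃ X, I.IsSolution k X}

/-! ## Determinantal sentences -/

/-- The `m × n` matrix of indeterminates, numbered row by row. -/
noncomputable def genericMatrix (R : Type) [CommRing R] (m n : ℕ) :
    Matrix (Fin m) (Fin n) (MvPolynomial (Fin (m * n)) R) :=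
  Matrix.of fun i j => MvPolynomial.X (finProdFinEquiv (i, j))

/-- The affine polynomial `⟨A ℓ, X⟩ - b ℓ`, with rational coefficients. -/
noncomputable def ARMInstance.affinePoly (I : ARMInstance) (l : Fin I.q) :
    MvPolynomial (Fin (I.m * I.n)) ℚ :=
  ∑ i, ∑ j, MvPolynomial.C (I.A l i j) * genericMatrix ℚ I.m I.n i j - MvPolynomial.C (I.b l)

/-- The `4 × 4` minor of the matrix of indeterminates with rows `r 0 < ⋯ < r 3` and columns
`c 0 < ⋯ < c 3`. -/
noncomputable def minorPoly {m n : ℕ} (r : Fin 4 ↪o Fin m) (c : Fin 4 ↪o Fin n) :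
    MvPolynomial (Fin (m * n)) ℤ :=
  ((genericMatrix ℤ m n).submatrix r c).det

/-- `S` is a sentence in the `m n` entries of the unknown matrix: the conjunction of the equalities
`⟨A ℓ, X⟩ - b ℓ = 0`, each multiplied by a positive integer that clears its denominators, and of
the vanishing of all `4 × 4` minors, each written as a sum of `24` terms. -/
def ARMInstance.IsDeterminantalSentence (I : ARMInstance) (S : ETRSentence) : Prop :=
  ∃ (affine : Fin I.q → SparsePoly (I.m * I.n)) (minors : List (SparsePoly (I.m * I.n))),
    S = ⟨I.m * I.n, QFFormula.allZero (List.ofFn affine ++ minors)⟩ ∧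
    (∀ l, ∃ d : ℕ, 0 < d ∧
      MvPolynomial.map (Int.castRingHom ℚ) (affine l).toMvPolynomial = (d : ℚ) • I.affinePoly l) ∧
    (∀ p ∈ minors, p.length = 24 ∧ ∃ r c, p.toMvPolynomial = minorPoly r c) ∧
    (∀ r c, ∃ p ∈ minors, p.toMvPolynomial = minorPoly r c)

/-! A real matrix has rank at most 3 if and only if all its 4 × 4 minors vanish, and multiplying an
affine equation by a positive common denominator does not change its solutions. Hence the cleared
constraints together with the minors, read as equations in the entries of `X`, are solvable exactly
when the instance is a yes-instance. This half rests on `Matrix.rank_le_three_iff` and is concluded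
in `ARMInstance.IsDeterminantalSentence.isTrue_iff`.

The sentence is short: there are polynomially many 4 × 4 minors because 4 is fixed, each has 24
terms, and a common denominator is a product of given denominators, so that bit lengths add up. One
point is delicate. Since `m` and `n` are written in binary, `m * n` is bounded by the input length
only if at least one matrix is present. For `q = 0` the instance is always a yes-instance and is
sent to a trivial sentence without variables. Accordingly, index ranges are obtained from the
lengths of the lists in the first matrix and never by counting up to a binary number.

Most of the work is to show that this map is computed by a stack machine in polynomial time.
Structured programs are compiled to such machines, one program step per machine step
(`StackProg.Exec.simulate`). Data are trees in Polish notation on one main stack, and `PolyTime` is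
the class of functions computed by programs on these trees. It is closed under composition, pairing,
case distinction and iteration with bounded states. A step pushes at most one symbol, so running
time bounds output size (`Computes.size_le`); this keeps compositions polynomial. Iteration needs a
size bound on all intermediate states (`PolyTime.foldl`). Arithmetic, the parser `readSymb`, the
clearing of denominators, the enumeration of minors and the output encoding are then built from such
folds. Finally `tm2ComputableInPolyTime_of_computes` passes from trees to words, and
`ARMInstance.encSentence_sentence` identifies the computed word with the encoding of the intended
sentence. -/

/-! ## Structured stack programs and their compilation to stack machines -/

/-- Structured programs over a family of stacks. A popped symbol is read through an embedding of
the stack alphabets into a common finite type `W`. -/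
inductive StackProg {K : Type} (Γ : K → Type) (W : Type) : Type
  | skip
  | push (k : K) (a : Γ k)
  | seq (p q : StackProg Γ W)
  | pop (k : K) (br : Option W → StackProg Γ W)
  | loop (k : K) (halts : Option W → Bool) (body : Option W → StackProg Γ W)

namespace StackProg

open Turing

variable {K : Type} {Γ : K → Type} {W : Type}

/-- The labels of the compiled program. -/
def Label : StackProg Γ W → Type
  | skip => Unit
  | push _ _ => Unit
  | seq p q => p.Label ⊕ q.Label
  | pop _ br => Option (Σ o, (br o).Label)
  | loop _ _ body => Option (Σ o, (body o).Label)

/-- A program has finitely many labels. -/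
@[reducible] noncomputable def labelFintype [Fintype W] : (p : StackProg Γ W) → Fintype p.Label
  | skip => inferInstanceAs (Fintype Unit)
  | push _ _ => inferInstanceAs (Fintype Unit)
  | seq p q => @instFintypeSum _ _ p.labelFintype q.labelFintype
  | pop _ br => @instFintypeOption _ (@Sigma.instFintype _ _ (fun o => (br o).labelFintype) _)
  | loop _ _ body => @instFintypeOption _ (@Sigma.instFintype _ _ (fun o => (body o).labelFintype) _)

/-- The label at which the execution of a program starts. -/
def entry : (p : StackProg Γ W) → p.Label
  | skip => ()
  | push _ _ => ()
  | seq p _ => Sum.inl p.entry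
  | pop _ _ => none
  | loop _ _ _ => none

/-- The code of a program whose labels are placed by `j` and which is left to the label `e`. -/
def compile (emb : ∀ k, Γ k → W) {Λ : Type} : (p : StackProg Γ W) → (p.Label → Λ) → Λ →
    p.Label → TM2.Stmt Γ Λ (Option W)
  | skip, _, e, _ => .goto fun _ => e
  | push k a, _, e, _ => .push k (fun _ => a) (.goto fun _ => e)
  | seq p q, j, e, l => Sum.rec (fun l => p.compile emb (fun l => j (.inl l)) (j (.inr q.entry)) l)
      (fun l => q.compile emb (fun l => j (.inr l)) e l) l
  | pop k br, j, e, l => Option.rec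
      (.pop k (fun _ o => o.map (emb k)) (.goto fun v => j (some ⟨v, (br v).entry⟩)))
      (fun l => (br l.1).compile emb (fun l' => j (some ⟨l.1, l'⟩)) e l.2) l
  | loop k halts body, j, e, l => Option.rec
      (.pop k (fun _ o => o.map (emb k))
        (.goto fun v => if halts v then e else j (some ⟨v, (body v).entry⟩)))
      (fun l => (body l.1).compile emb (fun l' => j (some ⟨l.1, l'⟩)) (j none) l.2) l

variable [DecidableEq K]

/-- `Exec emb p s t s'`: the program `p` leads from the stacks `s` to the stacks `s'` in `t`
steps. -/
inductive Exec (emb : ∀ k, Γ k → W) :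
    StackProg Γ W → (∀ k, List (Γ k)) → ℕ → (∀ k, List (Γ k)) → Prop
  | skip (s) : Exec emb skip s 1 s
  | push (k a s) : Exec emb (push k a) s 1 (Function.update s k (a :: s k))
  | seq {p q s t s' t' s''} : Exec emb p s t s' → Exec emb q s' t' s'' →
      Exec emb (seq p q) s (t + t') s''
  | pop {k br s t s'} :
      Exec emb (br ((s k).head?.map (emb k))) (Function.update s k (s k).tail) t s' →
      Exec emb (pop k br) s (t + 1) s'
  | loop_halt {k halts body s} : halts ((s k).head?.map (emb k)) = true →
      Exec emb (loop k halts body) s 1 (Function.update s k (s k).tail)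
  | loop_go {k halts body s t s' t' s''} : halts ((s k).head?.map (emb k)) = false →
      Exec emb (body ((s k).head?.map (emb k))) (Function.update s k (s k).tail) t s' →
      Exec emb (loop k halts body) s' t' s'' →
      Exec emb (loop k halts body) s (t + t' + 1) s''

theorem iterate_step_add {Λ σ : Type} {M : Λ → TM2.Stmt Γ Λ σ} {a b c : TM2.Cfg Γ Λ σ} {m n : ℕ}
    (h : (flip bind (TM2.step M))^[m] (some a) = some b)
    (h' : (flip bind (TM2.step M))^[n] (some b) = some c) :
    (flip bind (TM2.step M))^[m + n] (some a) = some c := by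
  rw [Nat.add_comm, Function.iterate_add_apply, h, h']

theorem iterate_step_one {Λ σ : Type} {M : Λ → TM2.Stmt Γ Λ σ} {l : Λ} {q : TM2.Stmt Γ Λ σ}
    (h : M l = q) (v : σ) (s : ∀ k, List (Γ k)) :
    (flip bind (TM2.step M))^[1] (some ⟨some l, v, s⟩) = some (TM2.stepAux q v s) := by
  subst h
  rfl

/-- The compiled program simulates the execution step by step. -/
theorem Exec.simulate {emb : ∀ k, Γ k → W} {p : StackProg Γ W} {s s' : ∀ k, List (Γ k)} {t : ℕ}
    (h : Exec emb p s t s') : ∀ {Λ : Type} (M : Λ → TM2.Stmt Γ Λ (Option W)) (j : p.Label → Λ)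
    (e : Λ), (∀ l, M (j l) = p.compile emb j e l) → ∀ v, ∃ v',
      (flip bind (TM2.step M))^[t] (some ⟨some (j p.entry), v, s⟩) = some ⟨some e, v', s'⟩ := by
  induction h with
  | skip s =>
    intro Λ M j e hM v
    exact ⟨v, iterate_step_one (hM ()) v s⟩
  | push k a s =>
    intro Λ M j e hM v
    exact ⟨v, iterate_step_one (hM ()) v s⟩
  | @seq p q s t s' t' s'' _ _ ih1 ih2 =>
    intro Λ M j e hM v
    -- The first program is left to the entry of the second, so the two runs fit together.
    obtain ⟨v1, h1⟩ := ih1 M (fun l => j (.inl l)) (j (.inr q.entry)) (fun l => hM (.inl l)) v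
    obtain ⟨v2, h2⟩ := ih2 M (fun l => j (.inr l)) e (fun l => hM (.inr l)) v1
    exact ⟨v2, iterate_step_add h1 h2⟩
  | @pop k br s t s' _ ih =>
    intro Λ M j e hM v
    obtain ⟨v1, h1⟩ := ih M (fun l => j (some ⟨_, l⟩)) e (fun l => hM (some ⟨_, l⟩))
      ((s k).head?.map (emb k))
    refine ⟨v1, ?_⟩
    rw [Nat.add_comm]
    exact iterate_step_add (iterate_step_one (hM none) v s) h1
  | @loop_halt k halts body s hs =>
    intro Λ M j e hM v
    exact ⟨(s k).head?.map (emb k), (iterate_step_one (hM none) v s).trans (by simp [compile, hs])⟩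
  | @loop_go k halts body s t s' t' s'' hs _ _ ih1 ih2 =>
    intro Λ M j e hM v
    -- The body is left to the head `j none` of the loop; there the hypothesis for the remaining
    -- rounds applies with unchanged `j` and `e`.
    obtain ⟨v1, h1⟩ := ih1 M (fun l => j (some ⟨_, l⟩)) (j none) (fun l => hM (some ⟨_, l⟩))
      ((s k).head?.map (emb k))
    obtain ⟨v2, h2⟩ := ih2 M j e hM v1
    refine ⟨v2, ?_⟩
    rw [Nat.add_comm]
    exact iterate_step_add ((iterate_step_one (hM none) v s).trans (by simp [compile, hs]))
      (iterate_step_add h1 h2)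

/-- The stack machine that runs a program and halts. -/
noncomputable def machine [Fintype K] [Fintype W] (emb : ∀ k, Γ k → W) (k₀ k₁ : K)
    [Fintype (Γ k₀)] (p : StackProg Γ W) : FinTM2 :=
  haveI := p.labelFintype
  { K := K
    k₀ := k₀
    k₁ := k₁
    Γ := Γ
    Λ := Option p.Label
    main := some p.entry
    σ := Option W
    initialState := none
    m := fun l => Option.rec (.load (fun _ => none) .halt) (p.compile emb some none) l }

/-- The additional step is the exit label: it resets the internal state, which otherwise still holds
the last popped symbol, since a halting configuration must carry the initial state. -/
theorem Exec.machine_evals [Fintype K] [Fintype W] {emb : ∀ k, Γ k → W} (k₀ k₁ : K)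
    [Fintype (Γ k₀)] {p : StackProg Γ W} {s s' : ∀ k, List (Γ k)} {t : ℕ}
    (h : Exec emb p s t s') :
    (flip bind (machine emb k₀ k₁ p).step)^[t + 1]
      (some (⟨some (some p.entry), none, s⟩ : TM2.Cfg Γ (Option p.Label) (Option W))) =
      some (⟨none, none, s'⟩ : TM2.Cfg Γ (Option p.Label) (Option W)) := by
  obtain ⟨v, hv⟩ := h.simulate (machine emb k₀ k₁ p).m some none (fun l => rfl) none
  exact iterate_step_add hv (iterate_step_one rfl v s')

end StackProg

/-! ## Symbolic expressions on stacks -/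

/-- Binary trees whose leaves carry symbols. -/
inductive SExpr
  | atom (s : Symb)
  | pair (x y : SExpr)

/-- The tokens of the Polish notation of a tree. -/
inductive Tok
  | atom (s : Symb)
  | pair
  deriving DecidableEq, Fintype

namespace SExpr

/-- The Polish notation of a tree. -/
def write : SExpr → List Tok
  | atom s => [.atom s]
  | pair x y => .pair :: (x.write ++ y.write)

/-- The length of the Polish notation of a tree. -/
def size (x : SExpr) : ℕ := x.write.length

@[simp] theorem size_atom (s : Symb) : (atom s).size = 1 := rfl

@[simp] theorem size_pair (x y : SExpr) : (pair x y).size = x.size + y.size + 1 := by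
  simp [size, write]

theorem size_pos (x : SExpr) : 0 < x.size := by
  cases x <;> simp

end SExpr

/-- The stacks of the machines below: input, output, the main stack and three auxiliary stacks. -/
inductive Reg
  | inp
  | out
  | main
  | hold
  | tmp
  | cnt
  deriving DecidableEq

instance : Fintype Reg :=
  ⟨{.inp, .out, .main, .hold, .tmp, .cnt}, by intro x; cases x <;> decide⟩

/-- The stack alphabets. -/
def Cell : Reg → Type
  | .inp => Symb
  | .out => Symb
  | .main => Tok
  | .hold => Tok
  | .tmp => Tok
  | .cnt => Tok

/-- The token of a stack symbol. -/
def readCell : ∀ k, Cell k → Tok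
  | .inp => Tok.atom
  | .out => Tok.atom
  | .main => id
  | .hold => id
  | .tmp => id
  | .cnt => id

/-- The stacks with given contents. -/
def stk (i o : List Symb) (m h t c : List Tok) : ∀ k, List (Cell k)
  | .inp => i
  | .out => o
  | .main => m
  | .hold => h
  | .tmp => t
  | .cnt => c

section stk

variable (i o : List Symb) (m h t c : List Tok)

theorem update_stk_inp (l : List Symb) :
    Function.update (stk i o m h t c) .inp l = stk l o m h t c := by
  funext k; cases k <;> rfl

theorem update_stk_out (l : List Symb) :
    Function.update (stk i o m h t c) .out l = stk i l m h t c := by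
  funext k; cases k <;> rfl

theorem update_stk_main (l : List Tok) :
    Function.update (stk i o m h t c) .main l = stk i o l h t c := by
  funext k; cases k <;> rfl

theorem update_stk_hold (l : List Tok) :
    Function.update (stk i o m h t c) .hold l = stk i o m l t c := by
  funext k; cases k <;> rfl

theorem update_stk_tmp (l : List Tok) :
    Function.update (stk i o m h t c) .tmp l = stk i o m h l c := by
  funext k; cases k <;> rfl

theorem update_stk_cnt (l : List Tok) :
    Function.update (stk i o m h t c) .cnt l = stk i o m h t l := by
  funext k; cases k <;> rfl

end stk

/-- Programs over these stacks. -/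
abbrev Prog : Type := StackProg Cell Tok

/-- `p` leads from the stacks `s` to the stacks `s'` in at most `n` steps. -/
def Runs (p : Prog) (s : ∀ k, List (Cell k)) (n : ℕ) (s' : ∀ k, List (Cell k)) : Prop :=
  ∃ t ≤ n, StackProg.Exec readCell p s t s'

namespace Runs

theorem mono {p : Prog} {s s' : ∀ k, List (Cell k)} {n n' : ℕ} (h : Runs p s n s') (hn : n ≤ n') :
    Runs p s n' s' := by
  obtain ⟨t, ht, h⟩ := h
  exact ⟨t, ht.trans hn, h⟩

theorem skip (s : ∀ k, List (Cell k)) : Runs .skip s 1 s := ⟨1, le_rfl, .skip s⟩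

theorem seq {p q : Prog} {s s' s'' : ∀ k, List (Cell k)} {n n' : ℕ} (h : Runs p s n s')
    (h' : Runs q s' n' s'') : Runs (.seq p q) s (n + n') s'' := by
  obtain ⟨t, ht, h⟩ := h
  obtain ⟨t', ht', h'⟩ := h'
  exact ⟨_, Nat.add_le_add ht ht', h.seq h'⟩

theorem push {k : Reg} {a : Cell k} {s s' : ∀ k, List (Cell k)}
    (h : Function.update s k (a :: s k) = s') : Runs (.push k a) s 1 s' :=
  ⟨1, le_rfl, h ▸ .push k a s⟩

theorem pop {k : Reg} {br : Option Tok → Prog} {s s₁ s' : ∀ k, List (Cell k)} {x : Option Tok}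
    {n : ℕ} (hx : (s k).head?.map (readCell k) = x) (hu : Function.update s k (s k).tail = s₁)
    (h : Runs (br x) s₁ n s') : Runs (.pop k br) s (n + 1) s' := by
  subst hx hu
  obtain ⟨t, ht, h⟩ := h
  exact ⟨_, Nat.add_le_add_right ht 1, h.pop⟩

theorem loop_halt {k : Reg} {halts : Option Tok → Bool} {body : Option Tok → Prog}
    {s s₁ : ∀ k, List (Cell k)} (h : halts ((s k).head?.map (readCell k)) = true)
    (hu : Function.update s k (s k).tail = s₁) : Runs (.loop k halts body) s 1 s₁ :=
  ⟨1, le_rfl, hu ▸ .loop_halt h⟩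

theorem loop_go {k : Reg} {halts : Option Tok → Bool} {body : Option Tok → Prog}
    {s s₁ s' s'' : ∀ k, List (Cell k)} {x : Option Tok} {n n' : ℕ}
    (hx : (s k).head?.map (readCell k) = x) (hu : Function.update s k (s k).tail = s₁)
    (hs : halts x = false) (h : Runs (body x) s₁ n s') (h' : Runs (.loop k halts body) s' n' s'') :
    Runs (.loop k halts body) s (n + n' + 1) s'' := by
  subst hx hu
  obtain ⟨t, ht, h⟩ := h
  obtain ⟨t', ht', hbody⟩ := h'
  exact ⟨_, by omega, .loop_go hs h hbody⟩

/-- Each step adds at most one symbol to a stack. -/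
theorem length_le {p : Prog} {s s' : ∀ k, List (Cell k)} {n : ℕ} (h : Runs p s n s') (k : Reg) :
    (s' k).length ≤ (s k).length + n := by
  have upd : ∀ (s : ∀ k, List (Cell k)) (k' : Reg),
      (Function.update s k' (s k').tail k).length ≤ (s k).length := by
    intro s k'
    by_cases hk : k = k'
    · subst hk; simp
    · simp [hk]
  obtain ⟨t, ht, h⟩ := h
  suffices (s' k).length ≤ (s k).length + t by omega
  clear ht
  induction h with
  | skip s => omega
  | push k' a s =>
    by_cases hk : k = k'
    · subst hk; simp
    · simp [hk]
  | seq _ _ ih1 ih2 => omega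
  | @pop k' _ s _ _ _ ih => have := upd s k'; omega
  | @loop_halt k' _ _ s _ => have := upd s k'; omega
  | @loop_go k' _ _ s _ _ _ _ _ _ _ ih1 ih2 => have := upd s k'; omega

variable {i o : List Symb} {m h t c : List Tok}

theorem push_out (a : Symb) :
    Runs (.push .out a) (stk i o m h t c) 1 (stk i (a :: o) m h t c) :=
  push (update_stk_out i o m h t c _)

theorem push_main (a : Tok) :
    Runs (.push .main a) (stk i o m h t c) 1 (stk i o (a :: m) h t c) :=
  push (update_stk_main i o m h t c _)

theorem push_hold (a : Tok) :
    Runs (.push .hold a) (stk i o m h t c) 1 (stk i o m (a :: h) t c) :=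
  push (update_stk_hold i o m h t c _)

theorem push_tmp (a : Tok) :
    Runs (.push .tmp a) (stk i o m h t c) 1 (stk i o m h (a :: t) c) :=
  push (update_stk_tmp i o m h t c _)

theorem push_cnt (a : Tok) :
    Runs (.push .cnt a) (stk i o m h t c) 1 (stk i o m h t (a :: c)) :=
  push (update_stk_cnt i o m h t c _)

theorem pop_main {br : Option Tok → Prog} {a : Tok} {n : ℕ} {s' : ∀ k, List (Cell k)}
    (H : Runs (br (some a)) (stk i o m h t c) n s') :
    Runs (.pop .main br) (stk i o (a :: m) h t c) (n + 1) s' :=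
  pop (k := .main) rfl (update_stk_main i o (a :: m) h t c _) H

theorem pop_hold {br : Option Tok → Prog} {a : Tok} {n : ℕ} {s' : ∀ k, List (Cell k)}
    (H : Runs (br (some a)) (stk i o m h t c) n s') :
    Runs (.pop .hold br) (stk i o m (a :: h) t c) (n + 1) s' :=
  pop (k := .hold) rfl (update_stk_hold i o m (a :: h) t c _) H

variable {halts : Option Tok → Bool} {body : Option Tok → Prog} {s' s'' : ∀ k, List (Cell k)}
  {n n' : ℕ}

theorem loop_main_halt {a : Tok} (hs : halts (some a) = true) :
    Runs (.loop .main halts body) (stk i o (a :: m) h t c) 1 (stk i o m h t c) :=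
  loop_halt (k := .main) hs (update_stk_main i o (a :: m) h t c _)

theorem loop_main_go {a : Tok} (hs : halts (some a) = false)
    (H : Runs (body (some a)) (stk i o m h t c) n s') (H' : Runs (.loop .main halts body) s' n' s'') :
    Runs (.loop .main halts body) (stk i o (a :: m) h t c) (n + n' + 1) s'' :=
  loop_go (k := .main) rfl (update_stk_main i o (a :: m) h t c _) hs H H'

theorem loop_inp_halt (hs : halts none = true) :
    Runs (.loop .inp halts body) (stk [] o m h t c) 1 (stk [] o m h t c) :=
  loop_halt (k := .inp) hs (update_stk_inp [] o m h t c _)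

theorem loop_inp_go {a : Symb} (hs : halts (some (.atom a)) = false)
    (H : Runs (body (some (.atom a))) (stk i o m h t c) n s')
    (H' : Runs (.loop .inp halts body) s' n' s'') :
    Runs (.loop .inp halts body) (stk (a :: i) o m h t c) (n + n' + 1) s'' :=
  loop_go (k := .inp) rfl (update_stk_inp (a :: i) o m h t c _) hs H H'

theorem loop_tmp_halt (hs : halts none = true) :
    Runs (.loop .tmp halts body) (stk i o m h [] c) 1 (stk i o m h [] c) :=
  loop_halt (k := .tmp) hs (update_stk_tmp i o m h [] c _)

theorem loop_tmp_go {a : Tok} (hs : halts (some a) = false)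
    (H : Runs (body (some a)) (stk i o m h t c) n s') (H' : Runs (.loop .tmp halts body) s' n' s'') :
    Runs (.loop .tmp halts body) (stk i o m h (a :: t) c) (n + n' + 1) s'' :=
  loop_go (k := .tmp) rfl (update_stk_tmp i o m h (a :: t) c _) hs H H'

theorem loop_cnt_halt (hs : halts none = true) :
    Runs (.loop .cnt halts body) (stk i o m h t []) 1 (stk i o m h t []) :=
  loop_halt (k := .cnt) hs (update_stk_cnt i o m h t [] _)

theorem loop_cnt_go {a : Tok} (hs : halts (some a) = false)
    (H : Runs (body (some a)) (stk i o m h t c) n s') (H' : Runs (.loop .cnt halts body) s' n' s'') :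
    Runs (.loop .cnt halts body) (stk i o m h t (a :: c)) (n + n' + 1) s'' :=
  loop_go (k := .cnt) rfl (update_stk_cnt i o m h t (a :: c) _) hs H H'

end Runs

/-! ### Moving, deleting and copying whole trees -/

namespace Prog

open StackProg Runs SExpr

/-- While the counter is nonempty, move a token from the main stack to `tmp`. -/
def grabMainLoop : Prog :=
  loop .cnt (fun o => o.isNone) fun _ => pop .main fun
    | some (.atom s) => push .tmp (Tok.atom s)
    | some .pair => seq (push .tmp Tok.pair) (seq (push .cnt Tok.pair) (push .cnt Tok.pair))
    | none => skip

/-- While the counter is nonempty, move a token from the stack `hold` to `tmp`. -/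
def grabHoldLoop : Prog :=
  loop .cnt (fun o => o.isNone) fun _ => pop .hold fun
    | some (.atom s) => push .tmp (Tok.atom s)
    | some .pair => seq (push .tmp Tok.pair) (seq (push .cnt Tok.pair) (push .cnt Tok.pair))
    | none => skip

/-- Move a tree from the main stack to `tmp`. -/
def grabMain : Prog := seq (push .cnt Tok.pair) grabMainLoop

/-- Move a tree from the stack `hold` to `tmp`. -/
def grabHold : Prog := seq (push .cnt Tok.pair) grabHoldLoop

/-- Push a token, if there is one. -/
def pushTok (f : Tok → Prog) : Option Tok → Prog
  | some a => f a
  | none => skip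

/-- Empty `tmp`, and treat each token by `f`. -/
def drain (f : Tok → Prog) : Prog := loop .tmp (fun o => o.isNone) (pushTok f)

variable {i o : List Symb} {m h t c : List Tok}

/-- The height of the counter is the number of trees still to be read: each token takes one off, and
a pair token puts two back for its subtrees. The continuation `H` lets the two subtrees of a pair be
handled one after the other. The factor 5 is the cost of a pair token: loop test, pop and three
pushes. -/
theorem runs_grabMainLoop (x : SExpr) {a : Tok} {n : ℕ} {s' : ∀ k, List (Cell k)}
    (H : Runs grabMainLoop (stk i o m h (x.write.reverse ++ t) c) n s') :
    Runs grabMainLoop (stk i o (x.write ++ m) h t (a :: c)) (n + 5 * x.size) s' := by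
  induction x generalizing m t c a n with
  | atom s =>
    refine (loop_cnt_go rfl (pop_main (push_tmp _)) H).mono ?_
    simp; omega
  | pair x y ihx ihy =>
    have hw : (pair x y).write ++ m = Tok.pair :: (x.write ++ (y.write ++ m)) := by simp [write]
    have hr : (pair x y).write.reverse ++ t =
        y.write.reverse ++ (x.write.reverse ++ Tok.pair :: t) := by simp [write]
    rw [hr] at H
    rw [hw]
    refine (loop_cnt_go rfl (pop_main ((push_tmp _).seq ((push_cnt Tok.pair).seq
      (push_cnt Tok.pair)))) (ihx (ihy H))).mono ?_
    simp; omega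

theorem runs_grabHoldLoop (x : SExpr) {a : Tok} {n : ℕ} {s' : ∀ k, List (Cell k)}
    (H : Runs grabHoldLoop (stk i o m h (x.write.reverse ++ t) c) n s') :
    Runs grabHoldLoop (stk i o m (x.write ++ h) t (a :: c)) (n + 5 * x.size) s' := by
  induction x generalizing h t c a n with
  | atom s =>
    refine (loop_cnt_go rfl (pop_hold (push_tmp _)) H).mono ?_
    simp; omega
  | pair x y ihx ihy =>
    have hw : (pair x y).write ++ h = Tok.pair :: (x.write ++ (y.write ++ h)) := by simp [write]
    have hr : (pair x y).write.reverse ++ t =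
        y.write.reverse ++ (x.write.reverse ++ Tok.pair :: t) := by simp [write]
    rw [hr] at H
    rw [hw]
    refine (loop_cnt_go rfl (pop_hold ((push_tmp _).seq ((push_cnt Tok.pair).seq
      (push_cnt Tok.pair)))) (ihx (ihy H))).mono ?_
    simp; omega

theorem runs_grabMain (x : SExpr) :
    Runs grabMain (stk i o (x.write ++ m) h [] []) (5 * x.size + 2)
      (stk i o m h x.write.reverse []) := by
  have H : Runs grabMainLoop (stk i o m h (x.write.reverse ++ []) []) 1 _ := loop_cnt_halt rfl
  simpa [grabMain] using ((push_cnt Tok.pair).seq (runs_grabMainLoop x H)).mono (by omega)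

theorem runs_grabHold (x : SExpr) :
    Runs grabHold (stk i o m (x.write ++ h) [] []) (5 * x.size + 2)
      (stk i o m h x.write.reverse []) := by
  have H : Runs grabHoldLoop (stk i o m h (x.write.reverse ++ []) []) 1 _ := loop_cnt_halt rfl
  simpa [grabHold] using ((push_cnt Tok.pair).seq (runs_grabHoldLoop x H)).mono (by omega)

/-- A grabbed tree lies on `tmp` in reverse; emptying `tmp` reverses it again and restores the
Polish notation. -/
theorem runs_drain_main : Runs (drain fun a => push .main a) (stk i o m h t c)
    (2 * t.length + 1) (stk i o (t.reverse ++ m) h [] c) := by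
  induction t generalizing m with
  | nil => exact loop_tmp_halt rfl
  | cons a t ih =>
    have := loop_tmp_go (halts := fun o => o.isNone) (body := pushTok fun a => push .main a) rfl
      (push_main (i := i) (o := o) (m := m) (h := h) (t := t) (c := c) a) ih
    simp only [List.reverse_cons, List.append_assoc, List.singleton_append]
    exact this.mono (by simp; omega)

theorem runs_drain_hold : Runs (drain fun a => push .hold a) (stk i o m h t c)
    (2 * t.length + 1) (stk i o m (t.reverse ++ h) [] c) := by
  induction t generalizing h with
  | nil => exact loop_tmp_halt rfl
  | cons a t ih =>
    have := loop_tmp_go (halts := fun o => o.isNone) (body := pushTok fun a => push .hold a) rfl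
      (push_hold (i := i) (o := o) (m := m) (h := h) (t := t) (c := c) a) ih
    simp only [List.reverse_cons, List.append_assoc, List.singleton_append]
    exact this.mono (by simp; omega)

theorem runs_drain_both : Runs (drain fun a => seq (push .main a) (push .hold a))
    (stk i o m h t c) (3 * t.length + 1)
    (stk i o (t.reverse ++ m) (t.reverse ++ h) [] c) := by
  induction t generalizing m h with
  | nil => exact loop_tmp_halt rfl
  | cons a t ih =>
    have := loop_tmp_go (halts := fun o => o.isNone)
      (body := pushTok fun a => seq (push .main a) (push .hold a)) rfl
      ((push_main (i := i) (o := o) (m := m) (h := h) (t := t) (c := c) a).seq (push_hold a)) ih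
    simp only [List.reverse_cons, List.append_assoc, List.singleton_append]
    exact this.mono (by simp; omega)

theorem runs_drain_skip : Runs (drain fun _ => skip) (stk i o m h t c)
    (2 * t.length + 1) (stk i o m h [] c) := by
  induction t with
  | nil => exact loop_tmp_halt rfl
  | cons a t ih =>
    have := loop_tmp_go (halts := fun o => o.isNone) (body := pushTok fun _ => skip) (a := a) rfl
      (Runs.skip _) ih
    exact this.mono (by simp; omega)

/-- Remove a tree from the main stack. -/
def drop : Prog := seq grabMain (drain fun _ => skip)

/-- Move a tree from the main stack to the stack `hold`. -/
def save : Prog := seq grabMain (drain fun a => push .hold a)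

/-- Move a tree from the stack `hold` to the main stack. -/
def restore : Prog := seq grabHold (drain fun a => push .main a)

/-- Double the tree on the main stack. -/
def dup : Prog :=
  seq (seq grabMain (drain fun a => seq (push .main a) (push .hold a))) restore

theorem runs_drop (x : SExpr) : Runs drop (stk i o (x.write ++ m) h [] [])
    (7 * x.size + 3) (stk i o m h [] []) :=
  ((runs_grabMain x).seq runs_drain_skip).mono (by simp [size]; omega)

theorem runs_save (x : SExpr) : Runs save (stk i o (x.write ++ m) h [] [])
    (7 * x.size + 3) (stk i o m (x.write ++ h) [] []) := by
  simpa [save] using ((runs_grabMain (i := i) (o := o) (m := m) (h := h) x).seq runs_drain_hold).mono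
    (n' := 7 * x.size + 3) (by simp [size]; omega)

theorem runs_restore (x : SExpr) : Runs restore (stk i o m (x.write ++ h) [] [])
    (7 * x.size + 3) (stk i o (x.write ++ m) h [] []) := by
  simpa [restore] using ((runs_grabHold (i := i) (o := o) (m := m) (h := h) x).seq runs_drain_main).mono
    (n' := 7 * x.size + 3) (by simp [size]; omega)

theorem runs_dup (x : SExpr) : Runs dup (stk i o (x.write ++ m) h [] [])
    (15 * x.size + 6) (stk i o (x.write ++ (x.write ++ m)) h [] []) := by
  have := (runs_grabMain (i := i) (o := o) (m := m) (h := h) x).seq runs_drain_both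
  simp only [List.reverse_reverse] at this
  exact (this.seq (runs_restore x)).mono (by simp [size]; omega)

end Prog

/-! ## Polynomial-time functions on coded data -/

theorem Polynomial.eval_nat_mono (P : Polynomial ℕ) {a b : ℕ} (h : a ≤ b) :
    P.eval a ≤ P.eval b := by
  rw [Polynomial.eval_eq_sum, Polynomial.eval_eq_sum]
  exact Finset.sum_le_sum fun i _ => Nat.mul_le_mul_left _ (Nat.pow_le_pow_left h i)

/-- Types whose elements are written as symbolic expressions. -/
class Coded (α : Type) where
  /-- The symbolic expression of an element. -/
  code : α → SExpr

open Coded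

/-- The length of the code of an element. -/
def codeSize {α : Type} [Coded α] (a : α) : ℕ := (code a).size

instance : Coded SExpr := ⟨id⟩

instance : Coded Symb := ⟨SExpr.atom⟩

instance : Coded Bool := ⟨fun b => .atom (.bit b)⟩

instance {α β : Type} [Coded α] [Coded β] : Coded (α × β) := ⟨fun x => .pair (code x.1) (code x.2)⟩

instance {α : Type} [Coded α] : Coded (List α) :=
  ⟨fun l => l.foldr (fun a x => .pair (code a) x) (.atom .endList)⟩

section codeSize

variable {α β : Type} [Coded α] [Coded β]

theorem codeSize_pos (a : α) : 0 < codeSize a := SExpr.size_pos _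

@[simp] theorem codeSize_symb (s : Symb) : codeSize s = 1 := rfl

@[simp] theorem codeSize_bool (b : Bool) : codeSize b = 1 := rfl

@[simp] theorem codeSize_prod (a : α) (b : β) : codeSize (a, b) = codeSize a + codeSize b + 1 :=
  SExpr.size_pair _ _

@[simp] theorem codeSize_nil : codeSize ([] : List α) = 1 := rfl

@[simp] theorem codeSize_cons (a : α) (l : List α) :
    codeSize (a :: l) = codeSize a + codeSize l + 1 := SExpr.size_pair _ _

theorem codeSize_list (l : List α) : codeSize l = (l.map fun a => codeSize a + 1).sum + 1 := by
  induction l with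
  | nil => rfl
  | cons a l ih => simp [ih]; ring

theorem length_lt_codeSize (l : List α) : l.length < codeSize l := by
  induction l with
  | nil => simp
  | cons a l ih => simp; omega

theorem codeSize_append (l l' : List α) : codeSize (l ++ l') + 1 = codeSize l + codeSize l' := by
  rw [codeSize_list, codeSize_list, codeSize_list]
  simp; omega

theorem codeSize_reverse (l : List α) : codeSize l.reverse = codeSize l := by
  rw [codeSize_list, codeSize_list]
  simp [List.sum_reverse]

theorem codeSize_le_of_mem {l : List α} {a : α} (h : a ∈ l) : codeSize a < codeSize l := by
  induction l with
  | nil => simp at h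
  | cons b l ih =>
    rcases List.mem_cons.1 h with rfl | h
    · simp
    · have := ih h; simp; omega

theorem codeSize_sublist {l l' : List α} (h : l.Sublist l') : codeSize l ≤ codeSize l' := by
  induction h with
  | slnil => simp
  | cons a _ ih => simp; omega
  | cons_cons a _ ih => simp; omega

theorem codeSize_le_of_forall {l : List α} {n : ℕ} (h : ∀ a ∈ l, codeSize a ≤ n) :
    codeSize l ≤ l.length * (n + 1) + 1 := by
  induction l with
  | nil => simp
  | cons a l ih =>
    have h1 := h a (by simp)
    have h2 := ih fun b hb => h b (by simp [hb])
    simp only [codeSize_cons, List.length_cons, add_mul, one_mul]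
    omega

end codeSize

/-- `p` replaces the tree `x` on the main stack by `y`, in at most `n` steps. -/
def Computes (p : Prog) (x : SExpr) (n : ℕ) (y : SExpr) : Prop :=
  ∀ i o m h, Runs p (stk i o (x.write ++ m) h [] []) n (stk i o (y.write ++ m) h [] [])

/-- A step pushes at most one symbol. This is the source of every bound on output sizes, in
particular of the one needed for composition. -/
theorem Computes.size_le {p : Prog} {x y : SExpr} {n : ℕ} (h : Computes p x n y) :
    y.size ≤ x.size + n := by
  have := (h [] [] [] []).length_le .main
  simp only [stk, List.append_nil] at this
  exact this

/-- A function is computed, on the codes, by a stack program in polynomial time. -/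
def PolyTime {α β : Type} [Coded α] [Coded β] (f : α → β) : Prop :=
  ∃ (p : Prog) (T : Polynomial ℕ), ∀ a, Computes p (code a) (T.eval (codeSize a)) (code (f a))

/-- The code lengths of the values are polynomially bounded. -/
def PolySize {α β : Type} [Coded α] [Coded β] (f : α → β) : Prop :=
  ∃ P : Polynomial ℕ, ∀ a, codeSize (f a) ≤ P.eval (codeSize a)

namespace PolyTime

open StackProg Runs Prog SExpr Polynomial

variable {α β γ δ : Type} [Coded α] [Coded β] [Coded γ] [Coded δ]

theorem polySize {f : α → β} (hf : PolyTime f) : PolySize f := by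
  obtain ⟨p, T, h⟩ := hf
  refine ⟨X + T, fun a => ?_⟩
  rw [eval_add, eval_X]
  exact (h a).size_le

/-- Only the codes matter. -/
theorem of_code {α' β' : Type} [Coded α'] [Coded β'] {f : α → β} (hf : PolyTime f) {f' : α' → β'}
    (e : α' → α) (he : ∀ a, code (e a) = code a) (h : ∀ a, code (f' a) = code (f (e a))) :
    PolyTime f' := by
  obtain ⟨p, T, hp⟩ := hf
  refine ⟨p, T, fun a => ?_⟩
  have := hp (e a)
  rw [codeSize, he] at this
  rw [h]
  exact this

theorem of_eq {f g : α → β} (hf : PolyTime f) (h : ∀ a, g a = f a) : PolyTime g := by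
  obtain rfl : g = f := funext h
  exact hf

theorem id : PolyTime fun a : α => a :=
  ⟨skip, 1, fun a i o m h => (Runs.skip _).mono (by simp)⟩

theorem comp {g : β → γ} {f : α → β} (hg : PolyTime g) (hf : PolyTime f) :
    PolyTime fun a => g (f a) := by
  obtain ⟨p, T, hp⟩ := hf
  obtain ⟨q, U, hq⟩ := hg
  -- The second program runs on an input of size at most `X + T`.
  refine ⟨seq p q, T + U.comp (X + T), fun a i o m h => ?_⟩
  refine ((hp a i o m h).seq (hq (f a) i o m h)).mono ?_
  have := U.eval_nat_mono (hp a).size_le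
  simpa [codeSize] using this

theorem pair {f : α → β} {g : α → γ} (hf : PolyTime f) (hg : PolyTime g) :
    PolyTime fun a => (f a, g a) := by
  obtain ⟨p, T, hp⟩ := hf
  obtain ⟨q, U, hq⟩ := hg
  -- The upper copy is turned into `f a` and parked on `hold` while the lower copy is turned into `g
  -- a`; then `f a` comes back on top, and a pair token joins the two trees.
  refine ⟨seq dup (seq p (seq save (seq q (seq restore (push .main Tok.pair))))),
    29 * X + 15 * T + U + 13, fun a i o m h => ?_⟩
  have hw : (code (f a, g a)).write ++ m =
      Tok.pair :: ((code (f a)).write ++ ((code (g a)).write ++ m)) := by simp [code, write]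
  rw [hw]
  refine ((runs_dup (code a)).seq ((hp a i o _ h).seq ((runs_save (code (f a))).seq
    ((hq a i o m _).seq ((runs_restore _).seq (push_main Tok.pair)))))).mono ?_
  have := (hp a).size_le
  simp only [eval_add, eval_mul, eval_X, eval_ofNat, codeSize] at this ⊢
  omega

theorem fst : PolyTime fun x : α × β => x.1 := by
  refine ⟨pop .main fun _ => seq save (seq drop restore), 21 * X + 10, fun x i o m h => ?_⟩
  have hw : (code x).write ++ m = Tok.pair :: ((code x.1).write ++ ((code x.2).write ++ m)) := by
    simp [code, write]
  rw [hw]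
  refine (pop_main ((runs_save _).seq ((runs_drop _).seq (runs_restore _)))).mono ?_
  obtain ⟨a, b⟩ := x
  rw [codeSize_prod]
  simp only [eval_add, eval_mul, eval_X, eval_ofNat, codeSize]
  omega

theorem snd : PolyTime fun x : α × β => x.2 := by
  refine ⟨pop .main fun _ => drop, 7 * X + 4, fun x i o m h => ?_⟩
  have hw : (code x).write ++ m = Tok.pair :: ((code x.1).write ++ ((code x.2).write ++ m)) := by
    simp [code, write]
  rw [hw]
  refine (pop_main (runs_drop _)).mono ?_
  obtain ⟨a, b⟩ := x
  rw [codeSize_prod]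
  simp only [eval_add, eval_mul, eval_X, eval_ofNat, codeSize]
  omega

theorem const_atom (s : Symb) : PolyTime fun _ : α => SExpr.atom s := by
  refine ⟨seq drop (push .main (Tok.atom s)), 7 * X + 4, fun x i o m h => ?_⟩
  refine ((runs_drop _).seq (push_main _)).mono ?_
  simp [codeSize]

theorem const_sexpr (x : SExpr) : PolyTime fun _ : α => x := by
  induction x with
  | atom s => exact const_atom s
  | pair x y hx hy => exact (hx.pair hy).of_code (fun a => a) (fun _ => rfl) fun _ => rfl

theorem const (b : β) : PolyTime fun _ : α => b :=
  (const_sexpr (code b)).of_code (fun a => a) (fun _ => rfl) fun _ => rfl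

/-- Case distinction on a symbol. -/
theorem symb_cases {f : Symb × α → β} (h : ∀ s, PolyTime fun a => f (s, a)) : PolyTime f := by
  choose p T hp using h
  refine ⟨pop .main fun _ => pop .main fun o => match o with
    | some (.atom s) => p s
    | _ => skip, X + ∑ s, T s, ?_⟩
  rintro ⟨s, a⟩ i o m h
  refine (pop_main (a := Tok.pair) (pop_main (a := Tok.atom s) (hp s a i o m h))).mono ?_
  have h1 : (T s).eval (codeSize a) ≤ (T s).eval (codeSize (s, a)) :=
    (T s).eval_nat_mono (by simp; omega)
  have h2 : (T s).eval (codeSize (s, a)) ≤ ∑ s', (T s').eval (codeSize (s, a)) :=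
    Finset.single_le_sum (f := fun s' => (T s').eval (codeSize (s, a)))
      (fun _ _ => Nat.zero_le _) (Finset.mem_univ s)
  have h3 := codeSize_pos a
  simp only [eval_add, eval_X, eval_finsetSum]
  have h4 : codeSize (s, a) = 1 + codeSize a + 1 := codeSize_prod s a
  omega

/-- Case distinction on a list. -/
theorem list_cases {f : List γ × α → β} (h₀ : PolyTime fun a => f ([], a))
    (h₁ : PolyTime fun x : (γ × List γ) × α => f (x.1.1 :: x.1.2, x.2)) : PolyTime f := by
  obtain ⟨p, T, hp⟩ := h₀
  obtain ⟨q, U, hq⟩ := h₁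
  -- A second pair token means that the list is nonempty. Both tokens are then pushed back, because
  -- `(c :: l, a)` and `((c, l), a)` have the same tree. For the empty list the second token is its
  -- end leaf, and only the tree of `a` is left.
  refine ⟨pop .main fun _ => pop .main fun o => match o with
    | some .pair => seq (push .main Tok.pair) (seq (push .main Tok.pair) q)
    | _ => p, T + U + 4, ?_⟩
  rintro ⟨l, a⟩ i o m h
  cases l with
  | nil =>
    refine (pop_main (a := Tok.pair) (pop_main (a := Tok.atom _) (hp a i o m h))).mono ?_
    have := T.eval_nat_mono (a := codeSize a) (b := codeSize (([] : List γ), a)) (by simp; omega)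
    simp only [eval_add, eval_ofNat]
    omega
  | cons c l =>
    refine (pop_main (a := Tok.pair) (pop_main (a := Tok.pair)
      ((push_main Tok.pair).seq ((push_main Tok.pair).seq (hq ((c, l), a) i o m h))))).mono ?_
    have : codeSize (c :: l, a) = codeSize ((c, l), a) := by simp
    rw [this]
    simp only [eval_add, eval_ofNat]
    omega

/-- Iteration of a step until a test on the state before the step is positive. -/
theorem iterate {start : γ → α} {next : α → α} {done : α → Bool} (hi : PolyTime start)
    (hn : PolyTime fun a => (done a, next a)) (N : γ → ℕ)
    (hgo : ∀ c, ∀ j < N c, done (next^[j] (start c)) = false)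
    (hdone : ∀ c, done (next^[N c] (start c)) = true) (P : Polynomial ℕ)
    (hN : ∀ c, N c ≤ P.eval (codeSize c))
    (hP : ∀ c, ∀ j ≤ N c, codeSize (next^[j] (start c)) ≤ P.eval (codeSize c)) :
    PolyTime fun c => next^[N c + 1] (start c) := by
  obtain ⟨p, T, hp⟩ := hi
  obtain ⟨q, U, hq⟩ := hn
  -- Each round computes the tree of `(done a, next a)` and removes its pair token, which exposes
  -- the flag `done a` for the next loop test. The flag refers to the state before the step, whence
  -- `N c + 1` applications of `next` in total.
  set L : Prog := loop .main (fun o => o == some (Tok.atom (.bit true)))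
    (fun _ => seq q (pop .main fun _ => skip)) with hL
  have step : ∀ a i o m h, Runs (seq q (pop .main fun _ => skip))
      (stk i o ((code a).write ++ m) h [] []) (U.eval (codeSize a) + 2)
      (stk i o (Tok.atom (.bit (done a)) :: ((code (next a)).write ++ m)) h [] []) :=
    fun a i o m h => (hq a i o m h).seq (pop_main (a := Tok.pair) (Runs.skip _))
  -- Induction on the number `k` of steps that separate the current state from the first one passing
  -- the test.
  have key : ∀ c i o m h, ∀ k ≤ N c, Runs L (stk i o
      (Tok.atom (.bit false) :: ((code (next^[N c - k] (start c))).write ++ m)) h [] [])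
      ((k + 1) * (U.eval (P.eval (codeSize c)) + 3) + 1)
      (stk i o ((code (next^[N c + 1] (start c))).write ++ m) h [] []) := by
    intro c i o m h k
    have bound : ∀ j ≤ N c, U.eval (codeSize (next^[j] (start c))) ≤
        U.eval (P.eval (codeSize c)) := fun j hj => U.eval_nat_mono (hP c j hj)
    induction k with
    | zero =>
      intro _
      have h1 := step (next^[N c] (start c)) i o m h
      rw [hdone c, ← Function.iterate_succ_apply' next] at h1
      have h2 := bound (N c) le_rfl
      rw [Nat.sub_zero]
      exact (loop_main_go (a := Tok.atom (.bit false)) rfl h1 (loop_main_halt rfl)).mono (by omega)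
    | succ k ih =>
      intro hk
      have h1 := step (next^[N c - (k + 1)] (start c)) i o m h
      rw [hgo c _ (by omega), ← Function.iterate_succ_apply' next,
        show (N c - (k + 1)).succ = N c - k by omega] at h1
      have h2 := bound (N c - (k + 1)) (by omega)
      refine (loop_main_go (a := Tok.atom (.bit false)) rfl h1 (ih (by omega))).mono ?_
      rw [add_mul (k + 1) 1]
      omega
  refine ⟨seq p (seq (push .main (Tok.atom (.bit false))) L),
    T + 1 + ((P + 1) * (U.comp P + 3) + 1), fun c i o m h => ?_⟩
  have h1 := key c i o m h (N c) le_rfl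
  rw [Nat.sub_self] at h1
  refine ((hp c i o m h).seq ((push_main _).seq h1)).mono ?_
  have h2 := Nat.mul_le_mul_right (U.eval (P.eval (codeSize c)) + 3) (Nat.succ_le_succ (hN c))
  simp only [eval_add, eval_mul, eval_comp, eval_one, eval_ofNat]
  simp only [Nat.succ_eq_add_one] at h2
  omega

end PolyTime

/-! ## From stack programs to Turing machines on words -/

namespace Prog

open StackProg Runs SExpr Coded

/-- Turn the input word into a tree on the main stack. -/
def readInput : Prog :=
  seq (loop .inp (fun o => o.isNone) (pushTok fun a => push .tmp a))
    (seq (push .main (Tok.atom .endList)) (drain fun a => seq (push .main a) (push .main Tok.pair)))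

/-- Push the symbol of a leaf on the output stack. -/
def pushOut : Tok → Prog
  | .atom s => push .out s
  | .pair => skip

/-- Turn the tree on the main stack into the output word. -/
def writeOutput : Prog :=
  seq (loop .main (fun o => o != some Tok.pair) fun _ => pop .main (pushTok fun a => push .tmp a))
    (drain pushOut)

variable {i o : List Symb} {m h t c : List Tok}

/-- The word is first reversed onto `tmp`. List cells can then be built from the last symbol to the
first, each by pushing the symbol and a pair token on top of the tail. -/
theorem runs_readInput (w : List Symb) : Runs readInput (stk w o m h [] c) (5 * w.length + 3)
    (stk [] o ((code w).write ++ m) h [] c) := by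
  have h1 : ∀ t, Runs (loop .inp (fun o => o.isNone) (pushTok fun a => push .tmp a))
      (stk w o m h t c) (2 * w.length + 1) (stk [] o m h ((w.map Tok.atom).reverse ++ t) c) := by
    induction w with
    | nil => exact fun t => loop_inp_halt rfl
    | cons s w ih =>
      intro t
      have := (loop_inp_go (halts := fun o => o.isNone) (body := pushTok fun a => push .tmp a)
        (a := s) rfl (push_tmp (i := w) (o := o) (m := m) (h := h) (t := t) (c := c) (Tok.atom s))
        (ih _))
      simp only [List.map_cons, List.reverse_cons, List.append_assoc, List.singleton_append]
      exact this.mono (by simp; omega)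
  have h2 : ∀ (u l : List Symb), Runs (drain fun a => seq (push .main a) (push .main Tok.pair))
      (stk [] o ((code l).write ++ m) h (u.map Tok.atom) c) (3 * u.length + 1)
      (stk [] o ((code (u.reverse ++ l)).write ++ m) h [] c) := by
    intro u
    induction u with
    | nil => exact fun l => loop_tmp_halt rfl
    | cons s u ih =>
      intro l
      have := loop_tmp_go (halts := fun o => o.isNone)
        (body := pushTok fun a => seq (push .main a) (push .main Tok.pair)) rfl
        ((push_main (i := []) (o := o) (m := (code l).write ++ m) (h := h) (t := u.map Tok.atom)
          (c := c) (Tok.atom s)).seq (push_main Tok.pair)) (ih (s :: l))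
      simp only [List.reverse_cons, List.append_assoc, List.singleton_append]
      exact this.mono (by simp; omega)
  have h3 := h2 w.reverse []
  rw [List.map_reverse, List.reverse_reverse, List.length_reverse, List.append_nil] at h3
  have h4 := h1 []
  rw [List.append_nil] at h4
  exact (h4.seq ((push_main (Tok.atom .endList)).seq h3)).mono (by omega)

theorem runs_writeOutput (w : List Symb) :
    Runs writeOutput (stk i o ((code w).write ++ m) h [] c) (5 * w.length + 2)
      (stk i (w ++ o) m h [] c) := by
  have h1 : ∀ t, Runs (loop .main (fun o => o != some Tok.pair) fun _ =>
        pop .main (pushTok fun a => push .tmp a))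
      (stk i o ((code w).write ++ m) h t c) (3 * w.length + 1)
      (stk i o m h ((w.map Tok.atom).reverse ++ t) c) := by
    induction w with
    | nil => exact fun t => loop_main_halt (a := Tok.atom .endList) rfl
    | cons s w ih =>
      intro t
      have := loop_main_go (halts := fun o => o != some Tok.pair)
        (body := fun _ => pop .main (pushTok fun a => push .tmp a)) (a := Tok.pair) rfl
        (pop_main (a := Tok.atom s) (push_tmp (i := i) (o := o) (m := (code w).write ++ m) (h := h)
          (t := t) (c := c) (Tok.atom s))) (ih _)
      simp only [List.map_cons, List.reverse_cons, List.append_assoc, List.singleton_append]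
      exact this.mono (by simp; omega)
  have h2 : ∀ (u : List Symb) (o : List Symb), Runs (drain pushOut)
      (stk i o m h (u.map Tok.atom) c) (2 * u.length + 1) (stk i (u.reverse ++ o) m h [] c) := by
    intro u
    induction u with
    | nil => exact fun l => loop_tmp_halt rfl
    | cons s u ih =>
      intro o
      have := loop_tmp_go (halts := fun o => o.isNone) (body := pushTok pushOut) (a := Tok.atom s)
        rfl (push_out (i := i) (o := o) (m := m) (h := h) (t := u.map Tok.atom) (c := c) s)
        (ih (s :: o))
      simp only [List.reverse_cons, List.append_assoc, List.singleton_append]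
      exact this.mono (by simp; omega)
  have h3 := h2 w.reverse o
  rw [List.map_reverse, List.reverse_reverse, List.length_reverse] at h3
  have h4 := h1 []
  rw [List.append_nil] at h4
  exact (h4.seq h3).mono (by omega)

end Prog

open Coded Turing in
/-- A polynomial-time function on coded words is computed by a stack machine in polynomial time. -/
theorem tm2ComputableInPolyTime_of_computes {α β : Type} {ea : α → List Symb} {eb : β → List Symb}
    {f : α → β} (p : Prog) (T : Polynomial ℕ) (hp : ∀ a,
      Computes p (code (ea a)) (T.eval (codeSize (ea a))) (code (eb (f a)))) :
    Nonempty (TM2ComputableInPolyTime ea eb f) := by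
  set q : Prog := .seq Prog.readInput (.seq p Prog.writeOutput) with hq
  have size_word : ∀ w : List Symb, codeSize w = 2 * w.length + 1 := by
    intro w
    induction w with
    | nil => rfl
    | cons s w ih => simp [ih]; omega
  -- Reading and writing are linear in the lengths of the two words, and the output length is
  -- controlled by the input size plus `T` through `Computes.size_le`. The constants 9 and 6 are
  -- generous.
  have hrun : ∀ a, ∃ t ≤ 9 * (2 * (ea a).length + 1) + 6 * T.eval (2 * (ea a).length + 1),
      StackProg.Exec readCell q (stk (ea a) [] [] [] [] []) t
        (stk [] (eb (f a)) [] [] [] []) := by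
    intro a
    have h1 := Prog.runs_readInput (o := []) (m := []) (h := []) (c := []) (ea a)
    have h2 := hp a [] [] [] []
    have h3 := Prog.runs_writeOutput (i := []) (o := []) (m := []) (h := []) (c := []) (eb (f a))
    simp only [List.append_nil] at h1 h2 h3
    refine (h1.seq (h2.seq h3)).mono ?_
    have h4 := (hp a).size_le
    have h5 : codeSize (ea a) + T.eval (codeSize (ea a)) ≥ codeSize (eb (f a)) := h4
    rw [size_word, size_word] at h5
    rw [size_word]
    omega
  let time : Polynomial ℕ :=
    9 * (2 * Polynomial.X + 1) + 6 * T.comp (2 * Polynomial.X + 1) + 1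
  have : Fintype (Cell .inp) := inferInstanceAs (Fintype Symb)
  refine ⟨⟨⟨StackProg.machine readCell .inp .out q, Equiv.refl _, Equiv.refl _⟩, time,
    fun a => ?_⟩⟩
  choose t ht hE using hrun
  refine ⟨⟨t a + 1, ?_⟩, ?_⟩
  · have h1 := (hE a).machine_evals .inp .out
    have e1 : initList (StackProg.machine readCell .inp .out q)
        (List.map (Equiv.refl Symb).invFun (ea a)) =
        (⟨some (some q.entry), none, stk (ea a) [] [] [] [] []⟩ :
          TM2.Cfg Cell (Option q.Label) (Option Tok)) := by
      have : List.map (Equiv.refl Symb).invFun (ea a) = ea a := List.map_id _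
      refine (congrArg (initList (StackProg.machine readCell .inp .out q)) this).trans ?_
      refine congrArg (TM2.Cfg.mk (some (some q.entry)) none) ?_
      funext k
      cases k <;> rfl
    have e2 : haltList (StackProg.machine readCell .inp .out q)
        (List.map (Equiv.refl Symb).invFun (eb (f a))) =
        (⟨none, none, stk [] (eb (f a)) [] [] [] []⟩ :
          TM2.Cfg Cell (Option q.Label) (Option Tok)) := by
      have : List.map (Equiv.refl Symb).invFun (eb (f a)) = eb (f a) := List.map_id _
      refine (congrArg (haltList (StackProg.machine readCell .inp .out q)) this).trans ?_
      refine congrArg (TM2.Cfg.mk none none) ?_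
      funext k
      cases k <;> rfl
    refine Eq.trans ?_ (h1.trans (congrArg some e2.symm))
    exact congrArg (fun c => (flip bind (StackProg.machine readCell .inp .out q).step)^[t a + 1]
      (some c)) e1
  · refine (Nat.add_le_add_right (ht a) 1).trans (le_of_eq ?_)
    simp [time]

/-! ## Polynomial-time list functions -/

open Coded

namespace PolyTime

open Polynomial

variable {α β γ δ σ : Type} [Coded α] [Coded β] [Coded γ] [Coded δ] [Coded σ]

theorem nil : PolyTime fun _ : α => ([] : List β) := const []

theorem cons {f : α → β} {g : α → List β} (hf : PolyTime f) (hg : PolyTime g) :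
    PolyTime fun a => f a :: g a :=
  (hf.pair hg).of_code (fun a => a) (fun _ => rfl) fun _ => rfl

/-- Case distinction on the value of a list-valued function. -/
theorem list_match {l : α → List β} {g : α → γ} {h : α → β → List β → γ} (hl : PolyTime l)
    (hg : PolyTime g) (hh : PolyTime fun x : α × β × List β => h x.1 x.2.1 x.2.2) :
    PolyTime fun a => match l a with
      | [] => g a
      | b :: l' => h a b l' := by
  have := list_cases (f := fun x : List β × α => match x.1 with
      | [] => g x.2
      | b :: l' => h x.2 b l') hg
    (hh.comp (snd.pair ((fst.comp fst).pair (snd.comp fst))) :)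
  exact this.comp (hl.pair id)

theorem tail {l : α → List β} (hl : PolyTime l) : PolyTime fun a => (l a).tail :=
  (list_match (h := fun _ _ l' => l') hl nil (snd.comp snd)).of_eq fun a => by
    cases l a <;> rfl

theorem headD {l : α → List β} {d : α → β} (hl : PolyTime l) (hd : PolyTime d) :
    PolyTime fun a => (l a).headD (d a) :=
  (list_match (h := fun _ b _ => b) hl hd (fst.comp snd)).of_eq fun a => by
    cases l a <;> rfl

/-- Case distinction on a Boolean. -/
theorem ite {c : α → Bool} {f g : α → β} (hc : PolyTime c) (hf : PolyTime f) (hg : PolyTime g) :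
    PolyTime fun a => if c a then f a else g a := by
  have h1 : PolyTime fun x : Symb × α => if x.1 = Symb.bit true then f x.2 else g x.2 := by
    refine symb_cases fun s => ?_
    by_cases hs : s = Symb.bit true
    · simpa [hs] using hf
    · simpa [hs] using hg
  have h2 : PolyTime fun a => Symb.bit (c a) :=
    hc.of_code (fun a => a) (fun _ => rfl) fun _ => rfl
  refine (h1.comp (h2.pair id)).of_eq fun a => ?_
  cases c a <;> simp

/-- Polynomial time of the step alone is not enough, since states could grow exponentially;
therefore the states after all prefixes have to be bounded. The loop state consists of the
parameter, the accumulator and the remaining list, and it is left unchanged once the list is empty.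
-/
theorem foldl {l : α → List β} {g : α → σ} {h : α → σ → β → σ} (hl : PolyTime l)
    (hg : PolyTime g) (hh : PolyTime fun x : α × σ × β => h x.1 x.2.1 x.2.2)
    (hP : ∃ P : Polynomial ℕ, ∀ a, ∀ l' : List β, l' <+: l a →
      codeSize (l'.foldl (h a) (g a)) ≤ P.eval (codeSize a)) :
    PolyTime fun a => (l a).foldl (h a) (g a) := by
  obtain ⟨P, hP⟩ := hP
  obtain ⟨Q, hQ⟩ := hl.polySize
  set next : α × σ × List β → α × σ × List β := fun x => match x.2.2 with
    | [] => x
    | b :: l' => (x.1, h x.1 x.2.1 b, l') with hnext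
  have iter : ∀ a s (l : List β) j, next^[j] (a, s, l) =
      (a, (l.take j).foldl (h a) s, l.drop j) := by
    intro a s l j
    induction j generalizing s l with
    | zero => simp
    | succ j ih =>
      rw [Function.iterate_succ_apply]
      cases l with
      | nil => simpa [hnext] using ih s []
      | cons b l => simpa [hnext] using ih (h a s b) l
  have hn : PolyTime fun x : α × σ × List β => (x.2.2.isEmpty, next x) := by
    refine (list_match (l := fun x : α × σ × List β => x.2.2) (g := fun x => (true, x))
      (h := fun x b l' => (false, (x.1, h x.1 x.2.1 b, l'))) (snd.comp snd)
      ((const true).pair id) ?_).of_eq ?_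
    · refine (const false).pair ((fst.comp fst).pair (pair ?_ (snd.comp snd)))
      exact hh.comp ((fst.comp fst).pair ((fst.comp (snd.comp fst)).pair (fst.comp snd)))
    · rintro ⟨a, s, l⟩
      cases l <;> rfl
  refine ((fst.comp snd).comp (iterate (start := fun a => (a, g a, l a)) (id.pair (hg.pair hl)) hn
    (fun a => (l a).length) ?_ ?_ (X + P + Q + 2) ?_ ?_)).of_eq ?_
  · intro a j hj
    simp only [iter]
    rw [List.isEmpty_eq_false_iff]
    simpa using hj
  · intro a
    simp [iter]
  · intro a
    have h1 := hQ a
    have h2 := length_lt_codeSize (l a)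
    simp only [eval_add, eval_X, eval_ofNat]
    omega
  · intro a j hj
    have h1 := hP a _ (List.take_prefix j (l a))
    have h2 := codeSize_sublist (List.drop_sublist j (l a))
    have h3 := hQ a
    simp only [iter, codeSize_prod, eval_add, eval_X, eval_ofNat]
    omega
  · intro a
    simp only [iter]
    -- `iterate` performs one round more than the list has items; that round finds an empty list and
    -- does nothing.
    rw [List.take_of_length_le (by omega)]

theorem reverse {l : α → List β} (hl : PolyTime l) : PolyTime fun a => (l a).reverse := by
  obtain ⟨Q, hQ⟩ := hl.polySize
  have key : ∀ l : List β, l.foldl (fun s b => b :: s) [] = l.reverse := fun l => by simp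
  refine (foldl (g := fun _ => []) (h := fun _ s b => b :: s) hl nil
    (cons (snd.comp snd) (fst.comp snd)) ⟨Q, fun a l' hl' => ?_⟩).of_eq fun a => (key _).symm
  rw [key, codeSize_reverse]
  exact (codeSize_sublist hl'.sublist).trans (hQ a)

theorem foldr {l : α → List β} {g : α → σ} {h : α → β → σ → σ} (hl : PolyTime l)
    (hg : PolyTime g) (hh : PolyTime fun x : α × β × σ => h x.1 x.2.1 x.2.2)
    (hP : ∃ P : Polynomial ℕ, ∀ a, ∀ l' : List β, l' <:+ l a →
      codeSize (l'.foldr (h a) (g a)) ≤ P.eval (codeSize a)) :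
    PolyTime fun a => (l a).foldr (h a) (g a) := by
  obtain ⟨P, hP⟩ := hP
  refine (foldl (h := fun a s b => h a b s) hl.reverse hg
    (hh.comp (fst.pair ((snd.comp snd).pair (fst.comp snd))))
    ⟨P, fun a l' hl' => ?_⟩).of_eq fun a => by rw [List.foldl_reverse]
  have := hP a l'.reverse (by simpa using List.reverse_suffix.2 hl')
  rwa [List.foldr_reverse] at this

theorem append {l l' : α → List β} (hl : PolyTime l) (hl' : PolyTime l') :
    PolyTime fun a => l a ++ l' a := by
  obtain ⟨P, hP⟩ := hl.polySize
  obtain ⟨Q, hQ⟩ := hl'.polySize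
  refine (foldr (g := l') (h := fun _ b s => b :: s) hl hl' (cons (fst.comp snd) (snd.comp snd))
    ⟨P + Q, fun a u hu => ?_⟩).of_eq fun a => by simp
  have h1 := codeSize_sublist hu.sublist
  have h2 := codeSize_append u (l' a)
  have h3 := hP a
  have h4 := hQ a
  have h5 : u.foldr (fun b s => b :: s) (l' a) = u ++ l' a := by simp
  rw [h5, eval_add]
  omega

theorem map {l : α → List β} {f : α → β → γ} (hl : PolyTime l)
    (hf : PolyTime fun x : α × β => f x.1 x.2) : PolyTime fun a => (l a).map (f a) := by
  obtain ⟨P, hP⟩ := hl.polySize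
  obtain ⟨Q, hQ⟩ := hf.polySize
  refine (foldr (g := fun _ => []) (h := fun a b s => f a b :: s) hl nil
    (cons (hf.comp (fst.pair (fst.comp snd))) (snd.comp snd))
    -- At most `P` items, each the value of `f` at a pair of size at most `X + P + 1`.
    ⟨P * (Q.comp (X + P + 1) + 1) + 1, fun a u hu => ?_⟩).of_eq fun a => by simp
  have h1 := codeSize_sublist hu.sublist
  have h2 := hP a
  have h3 := length_lt_codeSize u
  have h4 : ∀ c ∈ u.map (f a), codeSize c ≤ Q.eval (codeSize a + P.eval (codeSize a) + 1) := by
    intro c hc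
    obtain ⟨b, hb, rfl⟩ := List.mem_map.1 hc
    refine (hQ (a, b)).trans (Q.eval_nat_mono ?_)
    have := codeSize_le_of_mem hb
    rw [codeSize_prod]
    omega
  have h5 := codeSize_le_of_forall h4
  have h6 : u.foldr (fun b s => f a b :: s) [] = u.map (f a) := by simp
  rw [h6]
  refine h5.trans ?_
  simp only [eval_add, eval_mul, eval_comp, eval_X, eval_one, List.length_map]
  gcongr
  omega

theorem flatten {l : α → List (List β)} (hl : PolyTime l) : PolyTime fun a => (l a).flatten := by
  obtain ⟨P, hP⟩ := hl.polySize
  have key : ∀ l : List (List β), codeSize l.flatten ≤ codeSize l := by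
    intro l
    induction l with
    | nil => simp
    | cons b l ih =>
      have := codeSize_append b l.flatten
      simp
      omega
  have key' : ∀ l : List (List β), l.foldr (fun b s => b ++ s) [] = l.flatten := by
    intro l
    induction l with
    | nil => simp
    | cons b l ih => simp [ih]
  refine (foldr (g := fun _ => []) (h := fun _ b s => b ++ s) hl nil
    (append (fst.comp snd) (snd.comp snd)) ⟨P, fun a u hu => ?_⟩).of_eq fun a => (key' _).symm
  rw [key']
  exact (key u).trans ((codeSize_sublist hu.sublist).trans (hP a))

theorem flatMap {l : α → List β} {f : α → β → List γ} (hl : PolyTime l)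
    (hf : PolyTime fun x : α × β => f x.1 x.2) : PolyTime fun a => (l a).flatMap (f a) :=
  (flatten (map hl hf)).of_eq fun a => by rw [List.flatMap_def]

theorem getD {l : α → List β} (hl : PolyTime l) (d : β) (i : ℕ) :
    PolyTime fun a => (l a).getD i d := by
  induction i generalizing l with
  | zero => exact (headD hl (const d)).of_eq fun a => by cases l a <;> rfl
  | succ i ih => exact (ih (tail hl)).of_eq fun a => by cases l a <;> rfl

/-- A list with a fixed number of polynomial-time entries. -/
theorem map_const {τ : Type} (L : List τ) {F : τ → α → β} (hF : ∀ t, PolyTime (F t)) :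
    PolyTime fun a => L.map fun t => F t a := by
  induction L with
  | nil => exact nil
  | cons t L ih => exact cons (hF t) ih

end PolyTime

/-! ## Polynomial-time arithmetic -/

open Coded

theorem encodePosNum_eq_bits (p : PosNum) : Computability.encodePosNum p = (p : ℕ).bits := by
  induction p with
  | one => simp [Computability.encodePosNum]
  | bit0 p ih =>
    rw [Computability.encodePosNum, ih, PosNum.cast_bit0, ← two_mul,
      Nat.bit0_bits _ (PosNum.cast_pos ..).ne']
  | bit1 p ih =>
    rw [Computability.encodePosNum, ih, PosNum.cast_bit1, ← two_mul, Nat.bit1_bits]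

/-- The output format uses `Computability.encodeNat`, whereas arithmetic on digits is carried out
with `Nat.bits` and its recursion through `bodd` and `div2`. -/
theorem encodeNat_eq_bits (n : ℕ) : Computability.encodeNat n = n.bits := by
  have h : ∀ k : Num, Computability.encodeNum k = (k : ℕ).bits := by
    intro k
    cases k with
    | zero => rfl
    | pos p => exact encodePosNum_eq_bits p
  rw [Computability.encodeNat, h, Num.to_of_nat]

/-- Natural numbers are coded in binary. -/
instance : Coded ℕ := ⟨fun n => code n.bits⟩

/-- Integers are coded by the sign and the absolute value. -/
instance : Coded ℤ := ⟨fun z => code (decide (z < 0), z.natAbs)⟩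

/-- Rational numbers are coded in reduced form. -/
instance : Coded ℚ := ⟨fun r => code (r.num, r.den)⟩

theorem codeSize_nat (n : ℕ) : codeSize n = 2 * n.size + 1 := by
  have h : ∀ l : List Bool, codeSize l = 2 * l.length + 1 := by
    intro l
    induction l with
    | nil => rfl
    | cons b l ih => simp [ih]; omega
  rw [← Nat.size_eq_bits_len]
  exact h n.bits

theorem codeSize_int (z : ℤ) : codeSize z = codeSize z.natAbs + 2 := by
  have h : codeSize z = codeSize (decide (z < 0), z.natAbs) := rfl
  rw [h, codeSize_prod, codeSize_bool]
  omega

theorem bits_injective : Function.Injective Nat.bits := fun m n h => by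
  rw [← Computability.decode_encodeNat m, encodeNat_eq_bits, h, ← encodeNat_eq_bits,
    Computability.decode_encodeNat]

theorem bits_eq_nil {n : ℕ} : n.bits = [] ↔ n = 0 :=
  ⟨fun h => bits_injective (by rw [h, Nat.zero_bits]), fun h => by rw [h, Nat.zero_bits]⟩

theorem bits_of_ne_zero {n : ℕ} (h : n ≠ 0) : n.bits = n.bodd :: n.div2.bits := by
  conv_lhs => rw [← Nat.bit_bodd_div2 n]
  refine Nat.bits_append_bit _ _ fun h0 => ?_
  have := Nat.bodd_add_div2 n
  cases hb : n.bodd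
  · rw [h0, hb] at this
    exact absurd this.symm h
  · rfl

theorem bits_headD (n : ℕ) : n.bits.headD false = n.bodd := by
  rcases eq_or_ne n 0 with rfl | h
  · simp
  · rw [bits_of_ne_zero h, List.headD_cons]

theorem bits_tail (n : ℕ) : n.bits.tail = n.div2.bits := (Nat.div2_bits_eq_tail n).symm

theorem lt_two_pow_length_bits (n : ℕ) : n < 2 ^ n.bits.length := by
  rw [Nat.size_eq_bits_len]
  exact Nat.lt_size_self n

namespace PolyTime

open Polynomial

variable {α β γ δ σ : Type} [Coded α] [Coded β] [Coded γ] [Coded δ] [Coded σ]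

/-- Iteration over a list of a step that adds an amount of symbols bounded by the list item. -/
theorem foldl_of_le {l : α → List β} {g : α → σ} {h : α → σ → β → σ} (k : ℕ) (hl : PolyTime l)
    (hg : PolyTime g) (hh : PolyTime fun x : α × σ × β => h x.1 x.2.1 x.2.2)
    (hk : ∀ a s b, codeSize (h a s b) ≤ codeSize s + codeSize b + k) :
    PolyTime fun a => (l a).foldl (h a) (g a) := by
  obtain ⟨P, hP⟩ := hl.polySize
  obtain ⟨Q, hQ⟩ := hg.polySize
  have key : ∀ a (u : List β) s,
      codeSize (u.foldl (h a) s) ≤ codeSize s + (k + 1) * codeSize u := by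
    intro a u
    induction u with
    | nil => simp
    | cons b u ih =>
      intro s
      have h1 := ih (h a s b)
      have h2 := hk a s b
      have h3 := Nat.zero_le (k * codeSize b)
      simp only [List.foldl_cons, codeSize_cons, mul_add, add_mul, mul_one, one_mul] at h1 ⊢
      omega
  refine foldl hl hg hh ⟨Q + C (k + 1) * P, fun a u hu => (key a u _).trans ?_⟩
  have h1 := (codeSize_sublist hu.sublist).trans (hP a)
  simp only [eval_add, eval_mul, eval_C]
  exact Nat.add_le_add (hQ a) (Nat.mul_le_mul_left _ h1)

theorem foldr_of_le {l : α → List β} {g : α → σ} {h : α → β → σ → σ} (k : ℕ) (hl : PolyTime l)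
    (hg : PolyTime g) (hh : PolyTime fun x : α × β × σ => h x.1 x.2.1 x.2.2)
    (hk : ∀ a b s, codeSize (h a b s) ≤ codeSize s + codeSize b + k) :
    PolyTime fun a => (l a).foldr (h a) (g a) :=
  (foldl_of_le (h := fun a s b => h a b s) k hl.reverse hg
    (hh.comp (fst.pair ((snd.comp snd).pair (fst.comp snd)))) fun a s b => hk a b s).of_eq
    fun a => by rw [List.foldl_reverse]

theorem bool_comp {c : α → Bool} (F : Bool → β) (hc : PolyTime c) : PolyTime fun a => F (c a) :=
  (ite hc (const (F true)) (const (F false))).of_eq fun a => by cases c a <;> rfl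

theorem bool_comp₂ {c d : α → Bool} (F : Bool → Bool → β) (hc : PolyTime c) (hd : PolyTime d) :
    PolyTime fun a => F (c a) (d a) :=
  (ite hc (bool_comp (F true) hd) (bool_comp (F false) hd)).of_eq fun a => by cases c a <;> rfl

theorem bool_comp₃ {c d e : α → Bool} (F : Bool → Bool → Bool → β) (hc : PolyTime c)
    (hd : PolyTime d) (he : PolyTime e) : PolyTime fun a => F (c a) (d a) (e a) :=
  (ite hc (bool_comp₂ (F true) hd he) (bool_comp₂ (F false) hd he)).of_eq fun a => by
    cases c a <;> rfl

theorem isEmpty {l : α → List β} (hl : PolyTime l) : PolyTime fun a => (l a).isEmpty :=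
  (list_match (h := fun _ _ _ => false) hl (const true) (const false)).of_eq fun a => by
    cases l a <;> rfl

theorem natBits {f : α → ℕ} (hf : PolyTime f) : PolyTime fun a => (f a).bits :=
  hf.of_code (fun a => a) (fun _ => rfl) fun _ => rfl

theorem of_natBits {f : α → ℕ} (hf : PolyTime fun a => (f a).bits) : PolyTime f :=
  hf.of_code (fun a => a) (fun _ => rfl) fun _ => rfl

/-- One step of the addition of binary numbers: the state consists of the carry, the remaining
digits of the two summands and the digits of the sum, in reverse order. -/
def addStep (s : Bool × List Bool × List Bool × List Bool) :
    Bool × List Bool × List Bool × List Bool :=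
  if s.2.1.isEmpty && s.2.2.1.isEmpty && !s.1 then s else
    (Bool.atLeastTwo s.1 (s.2.1.headD false) (s.2.2.1.headD false), s.2.1.tail, s.2.2.1.tail,
      ((s.1 ^^ s.2.1.headD false) ^^ s.2.2.1.headD false) :: s.2.2.2)

/-- One step emits the parity of `m + n + c` and leaves summands and carry with total `(m + n + c) /
2`. The list `u` only counts rounds; by the hypothesis there are enough of them to reach 0, and
superfluous rounds leave the state unchanged. -/
theorem addStep_iterate {ι : Type} (u : List ι) (c : Bool) (m n : ℕ) (acc : List Bool)
    (h : m + n + c.toNat < 2 ^ u.length) :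
    u.foldl (fun s _ => addStep s) (c, m.bits, n.bits, acc) =
      (false, [], [], (m + n + c.toNat).bits.reverse ++ acc) := by
  induction u generalizing c m n acc with
  | nil =>
    simp only [List.length_nil, pow_zero] at h
    obtain ⟨rfl, rfl⟩ : m = 0 ∧ n = 0 := by omega
    cases c
    · simp
    · simp at h
  | cons b u ih =>
    rw [List.foldl_cons]
    by_cases h0 : m + n + c.toNat = 0
    · obtain ⟨rfl, rfl⟩ : m = 0 ∧ n = 0 := by omega
      cases c
      · have := ih false 0 0 acc (by simp)
        simpa [addStep] using this
      · simp at h0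
    · have hs : addStep (c, m.bits, n.bits, acc) =
          (Bool.atLeastTwo c m.bodd n.bodd, m.div2.bits, n.div2.bits,
            ((c ^^ m.bodd) ^^ n.bodd) :: acc) := by
        rw [addStep, if_neg]
        · simp only [bits_headD, bits_tail]
        · intro hc
          simp only [Bool.and_eq_true, List.isEmpty_iff, Bool.not_eq_true', bits_eq_nil] at hc
          simp [hc] at h0
      have hd : m.div2 + n.div2 + (Bool.atLeastTwo c m.bodd n.bodd).toNat =
          (m + n + c.toNat).div2 := by
        have h1 := Nat.bodd_add_div2 m
        have h2 := Nat.bodd_add_div2 n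
        rw [Nat.div2_val (m + n + c.toNat)]
        revert h1 h2
        cases m.bodd <;> cases n.bodd <;> cases c <;> simp [Bool.atLeastTwo] <;> omega
      have hb : ((c ^^ m.bodd) ^^ n.bodd) = (m + n + c.toNat).bodd := by
        rw [Nat.bodd_add, Nat.bodd_add]
        cases m.bodd <;> cases n.bodd <;> cases c <;> rfl
      rw [hs, ih, hd, hb, bits_of_ne_zero h0]
      · simp
      · rw [hd, Nat.div2_val]
        rw [List.length_cons, pow_succ] at h
        omega

theorem natAdd {f g : α → ℕ} (hf : PolyTime f) (hg : PolyTime g) :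
    PolyTime fun a => f a + g a := by
  have hs : PolyTime addStep := by
    have h1 : PolyTime fun s : Bool × List Bool × List Bool × List Bool => s.2.1 := fst.comp snd
    have h2 : PolyTime fun s : Bool × List Bool × List Bool × List Bool => s.2.2.1 :=
      fst.comp (snd.comp snd)
    have h3 := headD h1 (const false)
    have h4 := headD h2 (const false)
    refine ite (bool_comp₃ (fun x y z => x && y && !z) h1.isEmpty h2.isEmpty fst) id
      ((bool_comp₃ Bool.atLeastTwo fst h3 h4).pair (h1.tail.pair (h2.tail.pair
        (cons (bool_comp₃ (fun x y z => (x ^^ y) ^^ z) fst h3 h4) (snd.comp (snd.comp snd))))))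
  -- The concatenated digits, with one more item, serve as a round counter that is long enough for
  -- the sum.
  have h1 : PolyTime fun a => (true :: ((f a).bits ++ (g a).bits)).foldl (fun s _ => addStep s)
      (false, (f a).bits, (g a).bits, ([] : List Bool)) := by
    refine foldl_of_le 2 (cons (const true) (append hf.natBits hg.natBits))
      ((const false).pair (hf.natBits.pair (hg.natBits.pair nil)))
      (hs.comp (fst.comp snd)) ?_
    rintro - ⟨c, x, y, z⟩ -
    have hx := codeSize_sublist x.tail_sublist
    have hy := codeSize_sublist y.tail_sublist
    rw [addStep]
    split_ifs
    · omega
    · simp; omega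
  refine of_natBits ((reverse ((snd.comp (snd.comp snd)).comp h1)).of_eq fun a => ?_)
  rw [addStep_iterate]
  · simp
  · have h2 : f a < 2 ^ (f a).bits.length := lt_two_pow_length_bits _
    have h3 : g a < 2 ^ (g a).bits.length := lt_two_pow_length_bits _
    have h4 : 0 < 2 ^ (f a).bits.length := by positivity
    have h5 : 0 < 2 ^ (g a).bits.length := by positivity
    simp only [Bool.toNat_false, List.length_cons, List.length_append, pow_succ, pow_add]
    nlinarith

theorem natMul {f g : α → ℕ} (hf : PolyTime f) (hg : PolyTime g) :
    PolyTime fun a => f a * g a := by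
  obtain ⟨P, hP⟩ := hf.polySize
  obtain ⟨Q, hQ⟩ := hg.polySize
  -- The product is evaluated by Horner's scheme from the most significant digit. The summand `n` on
  -- the left makes the induction close, as `2 * s + n + n = 2 * (s + n)`; the bound keeps partial
  -- products at the size of `n` plus the number of digits.
  have key : ∀ (n : ℕ) (l : List Bool), l.foldr (fun b s => s + s + if b then n else 0) 0 + n ≤
      n * 2 ^ l.length := by
    intro n l
    induction l with
    | nil => simp
    | cons b l ih =>
      simp only [List.foldr_cons, List.length_cons, pow_succ]
      split_ifs <;> linarith
  have key' : ∀ m n : ℕ, m.bits.foldr (fun b s => s + s + if b then n else 0) 0 = m * n := by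
    intro m n
    induction m using Nat.binaryRec' with
    | zero => simp
    | bit b m hm ih =>
      rw [Nat.bits_append_bit _ _ hm, List.foldr_cons, ih]
      cases b <;> simp [Nat.bit_val] <;> ring
  have step : PolyTime fun x : α × Bool × ℕ =>
      x.2.2 + x.2.2 + if x.2.1 then g x.1 else 0 :=
    natAdd (natAdd (snd.comp snd) (snd.comp snd)) (ite (fst.comp snd) (hg.comp fst) (const 0))
  have main : PolyTime fun a =>
      (f a).bits.foldr (fun b s => s + s + if b then g a else 0) 0 := by
    refine foldr (g := fun _ => (0 : ℕ))
      (h := fun a (b : Bool) (s : ℕ) => s + s + if b then g a else 0) hf.natBits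
      (const 0) step ⟨2 * P + Q, fun a u hu => ?_⟩
    have h1 := key (g a) u
    have h2 : codeSize (f a) = codeSize (f a).bits := rfl
    have h3 := (codeSize_sublist hu.sublist).trans (h2 ▸ hP a)
    have h4 := length_lt_codeSize u
    have h5 : (u.foldr (fun (b : Bool) (s : ℕ) => s + s + if b then g a else 0) 0).size ≤
        (g a).size + u.length := by
      rcases eq_or_ne (g a) 0 with h0 | h0
      · rw [h0, zero_mul, add_zero, Nat.le_zero] at h1
        rw [h0, h1]
        simp
      · rw [Nat.size_le, pow_add]
        have h6 : g a * 2 ^ u.length < 2 ^ (g a).size * 2 ^ u.length :=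
          Nat.mul_lt_mul_of_pos_right (Nat.lt_size_self _) (by positivity)
        omega
    have h6 := hQ a
    rw [codeSize_nat] at h6 ⊢
    simp only [eval_add, eval_mul, eval_ofNat]
    omega
  exact main.of_eq fun a => (key' _ _).symm

theorem natEq {f g : α → ℕ} (hf : PolyTime f) (hg : PolyTime g) :
    PolyTime fun a => decide (f a = g a) := by
  -- The digits of the second number are consumed along those of the first. The default `!b` forces
  -- a mismatch if the second list ends too early; the final emptiness test detects that it is too
  -- long.
  have key : ∀ (x y : List Bool) (c : Bool),
      ((x.foldl (fun s b => (s.1 && s.2.headD (!b) == b, s.2.tail)) (c, y)).1 &&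
        (x.foldl (fun s b => (s.1 && s.2.headD (!b) == b, s.2.tail)) (c, y)).2.isEmpty) = true ↔
      c = true ∧ x = y := by
    intro x
    induction x with
    | nil => intro y c; cases y <;> simp
    | cons b x ih =>
      intro y c
      rw [List.foldl_cons, ih]
      cases y with
      | nil => cases b <;> simp
      | cons d y => cases b <;> cases d <;> simp
  have h1 : PolyTime fun a => (f a).bits.foldl
      (fun (s : Bool × List Bool) b => (s.1 && s.2.headD (!b) == b, s.2.tail))
      (true, (g a).bits) := by
    refine foldl_of_le 0 hf.natBits ((const true).pair hg.natBits) ?_ ?_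
    · have h2 : PolyTime fun x : α × (Bool × List Bool) × Bool => x.2.2 := snd.comp snd
      have h3 : PolyTime fun x : α × (Bool × List Bool) × Bool => x.2.1.2 :=
        snd.comp (fst.comp snd)
      exact (bool_comp₃ (fun x y z => x && y == z) (fst.comp (fst.comp snd))
        (headD h3 (bool_comp (fun b => !b) h2)) h2).pair h3.tail
    · rintro - ⟨c, x⟩ b
      have := codeSize_sublist x.tail_sublist
      simp; omega
  refine (bool_comp₂ (fun x y => x && y) (fst.comp h1) (isEmpty (snd.comp h1))).of_eq fun a => ?_
  rw [Bool.eq_iff_iff, key, decide_eq_true_iff]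
  exact ⟨fun h => ⟨rfl, h ▸ rfl⟩, fun h => bits_injective h.2⟩

theorem natPos {f : α → ℕ} (hf : PolyTime f) : PolyTime fun a => decide (f a ≠ 0) :=
  (bool_comp (fun b => !b) (natEq hf (const 0))).of_eq fun a => by simp

theorem intPair {s : α → Bool} {n : α → ℕ} (hs : PolyTime s) (hn : PolyTime n) :
    PolyTime fun a => if s a then -(n a : ℤ) else n a := by
  -- The sign bit is cleared when the absolute value is 0, because the code of the integer 0 has
  -- sign `false`.
  refine ((bool_comp₂ (fun x y => x && y) hs (natPos hn)).pair hn).of_code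
    (f' := fun a => if s a then -(n a : ℤ) else n a) (fun a => a) (fun _ => rfl) fun a => ?_
  have h : ∀ z : ℤ, code z = code (decide (z < 0), z.natAbs) := fun _ => rfl
  rw [h]
  congr 2
  · cases s a <;> simp [Nat.pos_iff_ne_zero]
  · cases s a <;> simp

theorem intSign {f : α → ℤ} (hf : PolyTime f) : PolyTime fun a => decide (f a < 0) :=
  fst.comp ((hf.of_code (fun a => a) (fun _ => rfl) fun _ => rfl :
    PolyTime fun a => (decide (f a < 0), (f a).natAbs)))

theorem natAbs {f : α → ℤ} (hf : PolyTime f) : PolyTime fun a => (f a).natAbs :=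
  snd.comp ((hf.of_code (fun a => a) (fun _ => rfl) fun _ => rfl :
    PolyTime fun a => (decide (f a < 0), (f a).natAbs)))

theorem intNeg {f : α → ℤ} (hf : PolyTime f) : PolyTime fun a => -f a :=
  (intPair (bool_comp (fun b => !b) (intSign hf)) (natAbs hf)).of_eq fun a => by
    by_cases h : f a < 0
    · simp [h, abs_of_neg h]
    · simp [h, abs_of_nonneg (not_lt.1 h)]

theorem intMulNat {f : α → ℤ} {g : α → ℕ} (hf : PolyTime f) (hg : PolyTime g) :
    PolyTime fun a => f a * (g a : ℤ) :=
  (intPair (intSign hf) (natMul (natAbs hf) hg)).of_eq fun a => by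
    by_cases h : f a < 0
    · simp only [h, decide_true, if_true, Nat.cast_mul, Int.natCast_natAbs, abs_of_neg h]
      ring
    · simp only [h, decide_false, Nat.cast_mul, Int.natCast_natAbs, abs_of_nonneg (not_lt.1 h)]
      simp

theorem ratNum {f : α → ℚ} (hf : PolyTime f) : PolyTime fun a => (f a).num :=
  fst.comp (hf.of_code (fun a => a) (fun _ => rfl) fun _ => rfl :
    PolyTime fun a => ((f a).num, (f a).den))

theorem ratDen {f : α → ℚ} (hf : PolyTime f) : PolyTime fun a => (f a).den :=
  snd.comp (hf.of_code (fun a => a) (fun _ => rfl) fun _ => rfl :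
    PolyTime fun a => ((f a).num, (f a).den))

/-- The list `0, …, n - 1`, where `n` is the length of a list. -/
theorem range_length {l : α → List β} (hl : PolyTime l) :
    PolyTime fun a => List.range (l a).length := by
  obtain ⟨P, hP⟩ := hl.polySize
  have key : ∀ u : List β, u.foldl (fun (s : List ℕ × ℕ) _ => (s.1 ++ [s.2], s.2 + 1)) ([], 0) =
      (List.range u.length, u.length) := by
    intro u
    induction u using List.reverseRecOn with
    | nil => rfl
    | append_singleton u b ih =>
      rw [List.foldl_append, ih]
      simp [List.range_succ]
  have hs : ∀ n : ℕ, codeSize n ≤ 2 * n + 1 := fun n => by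
    rw [codeSize_nat]
    have := Nat.size_le.2 n.lt_two_pow_self
    omega
  refine (fst.comp (foldl (g := fun _ => (([] : List ℕ), 0))
    (h := fun _ (s : List ℕ × ℕ) _ => (s.1 ++ [s.2], s.2 + 1)) hl (const _) ?_
    ⟨P * (2 * P + 2) + 2 * P + 3, fun a u hu => ?_⟩)).of_eq fun a => by rw [key]
  · have h1 : PolyTime fun x : α × (List ℕ × ℕ) × β => x.2.1.2 := snd.comp (fst.comp snd)
    exact (append (fst.comp (fst.comp snd)) (cons h1 nil)).pair (natAdd h1 (const 1))
  · have h1 := (length_lt_codeSize u).le.trans ((codeSize_sublist hu.sublist).trans (hP a))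
    have h2 : ∀ k ∈ List.range u.length, codeSize k ≤ 2 * P.eval (codeSize a) + 1 := by
      intro k hk
      have := List.mem_range.1 hk
      exact (hs k).trans (by omega)
    have h3 := codeSize_le_of_forall h2
    have h4 := hs u.length
    rw [List.length_range] at h3
    have h5 := Nat.mul_le_mul_right (2 * P.eval (codeSize a) + 2) h1
    rw [show 2 * P.eval (codeSize a) + 1 + 1 = 2 * P.eval (codeSize a) + 2 from rfl] at h3
    simp only [key, codeSize_prod, eval_add, eval_mul, eval_ofNat]
    omega

/-- The number of occurrences of a number in a list. -/
theorem count {l : α → List ℕ} {k : α → ℕ} (hl : PolyTime l) (hk : PolyTime k) :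
    PolyTime fun a => (l a).count (k a) := by
  have key : ∀ (k : ℕ) (u : List ℕ) (c : ℕ),
      u.foldl (fun (s : ℕ) b => s + if decide (b = k) then 1 else 0) c = c + u.count k := by
    intro k u
    induction u with
    | nil => simp
    | cons b u ih =>
      intro c
      rw [List.foldl_cons, ih, List.count_cons]
      simp only [decide_eq_true_eq, beq_iff_eq]
      omega
  refine (foldl_of_le (g := fun _ => (0 : ℕ))
    (h := fun a (s : ℕ) b => s + if decide (b = k a) then 1 else 0) 2 hl (const 0)
    (natAdd (fst.comp snd) (ite (natEq (snd.comp snd) (hk.comp fst)) (const 1) (const 0)))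
    fun a s b => ?_).of_eq fun a => by rw [key, zero_add]
  have h : (s + if decide (b = k a) then 1 else 0).size ≤ s.size + 1 := by
    rw [Nat.size_le, pow_succ]
    have := Nat.lt_size_self s
    split_ifs <;> omega
  rw [codeSize_nat, codeSize_nat]
  omega

theorem encNat {f : α → ℕ} (hf : PolyTime f) : PolyTime fun a => encNat (f a) := by
  refine (append (hf.of_code (f' := fun a => (f a).bits.map Symb.bit) (fun a => a) (fun _ => rfl)
    fun a => ?_) (const [Symb.endNum])).of_eq fun a => by
      rw [_root_.encNat, encodeNat_eq_bits]
  have h : ∀ l : List Bool, code (l.map Symb.bit) = code l := by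
    intro l
    induction l with
    | nil => rfl
    | cons b l ih => exact congrArg (SExpr.pair _) ih
  exact h _

theorem encInt {f : α → ℤ} (hf : PolyTime f) : PolyTime fun a => encInt (f a) :=
  cons (bool_comp Symb.bit (intSign hf)) (encNat (natAbs hf))

theorem encList {l : α → List β} {e : β → List Symb} (hl : PolyTime l) (he : PolyTime e) :
    PolyTime fun a => encList e (l a) := by
  refine (append (flatMap (f := fun _ b => Symb.item :: e b) hl
    (cons (const _) (he.comp snd))) (const [Symb.endList])).of_eq fun a => ?_
  induction l a with
  | nil => rfl
  | cons b l ih => simp [_root_.encList, ih]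

end PolyTime

/-! ## Reading an instance of affine rank minimization -/

open Coded

instance {α : Type} [Coded α] {n : ℕ} : Coded (Fin n → α) := ⟨fun v => code (List.ofFn v)⟩

theorem code_ofFn {α β : Type} [Coded α] [Coded β] {g : α → β} (h : ∀ a, code (g a) = code a)
    {n : ℕ} (v : Fin n → α) : code (List.ofFn fun i => g (v i)) = code v := by
  have key : ∀ l : List α, code (l.map g) = code l := by
    intro l
    induction l with
    | nil => rfl
    | cons a l ih => exact congrArg₂ SExpr.pair (h a) ih
  rw [← Function.comp_def, ← List.map_ofFn, key]
  rfl

instance : Coded ARMInstance := ⟨fun I => code (encARM I)⟩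

/-- Reading a word from right to left: the trees of the objects read so far are kept on a stack,
together with a flag for numbers. -/
def readSymb : Symb → List (Bool × SExpr) → List (Bool × SExpr)
  | .endNum, s => (true, .atom .endList) :: s
  | .endList, s => (false, .atom .endList) :: s
  | .bit b, s => match s with
    | [] => []
    | x :: s => (x.1, .pair (.atom (.bit b)) x.2) :: s
  | .item, s => match s with
    | [] => []
    | x :: s => match s with
      | [] => []
      | y :: s => if y.1 then
          match s with
          | [] => []
          | z :: s => (false, .pair (.pair x.2 y.2) z.2) :: s
        else (false, .pair x.2 y.2) :: s
  | _, s => s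

theorem readSymb_encNat (k : ℕ) (s : List (Bool × SExpr)) :
    (encNat k).foldr readSymb s = (true, code k) :: s := by
  have h : ∀ l : List Bool, (l.map Symb.bit ++ [Symb.endNum]).foldr readSymb s =
      (true, code l) :: s := by
    intro l
    induction l with
    | nil => rfl
    | cons b l ih =>
      rw [List.map_cons, List.cons_append, List.foldr_cons, ih]
      rfl
  rw [encNat, encodeNat_eq_bits, h]
  rfl

/-- The sign is one more bit in front of the digits, both in the word and in the tree. -/
theorem readSymb_encInt (z : ℤ) (s : List (Bool × SExpr)) :
    (encInt z).foldr readSymb s = (true, code z) :: s := by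
  rw [encInt, List.foldr_cons, readSymb_encNat]
  rfl

/-- At an item marker the stack holds numerator, denominator and the rest of the list. The flag of
the second tree marks it as a denominator; for items that are themselves lists, the second tree is
the unflagged rest. -/
theorem readSymb_encList_encRat (l : List ℚ) (s : List (Bool × SExpr)) :
    (encList encRat l).foldr readSymb s = (false, code l) :: s := by
  induction l with
  | nil => rfl
  | cons r l ih =>
    rw [encList, List.foldr_cons, List.foldr_append, ih, encRat, List.foldr_append,
      readSymb_encNat, readSymb_encInt]
    rfl

theorem readSymb_encList {α : Type} [Coded α] {e : α → List Symb}
    (he : ∀ a s, (e a).foldr readSymb s = (false, code a) :: s) (l : List α)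
    (s : List (Bool × SExpr)) : (encList e l).foldr readSymb s = (false, code l) :: s := by
  induction l with
  | nil => rfl
  | cons a l ih =>
    rw [encList, List.foldr_cons, List.foldr_append, ih, he]
    rfl

theorem readSymb_encARM (I : ARMInstance) : (encARM I).foldr readSymb [] =
    [(true, code I.m), (true, code I.n), (true, code I.q),
      (false, code (α := Fin I.q → Fin I.m → Fin I.n → ℚ) I.A), (false, code I.b)] := by
  have h1 : ∀ {n : ℕ} (v : Fin n → ℚ) s,
      (encVec encRat v).foldr readSymb s = (false, code v) :: s :=
    fun v s => readSymb_encList_encRat _ s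
  have h2 : ∀ {m n : ℕ} (v : Fin m → Fin n → ℚ) s,
      (encVec (encVec encRat) v).foldr readSymb s = (false, code v) :: s :=
    fun v s => readSymb_encList h1 _ s
  have h3 : ∀ {q m n : ℕ} (v : Fin q → Fin m → Fin n → ℚ) s,
      (encVec (encVec (encVec encRat)) v).foldr readSymb s = (false, code v) :: s :=
    fun v s => readSymb_encList h2 _ s
  rw [encARM, List.foldr_append, h1, List.foldr_append, List.foldr_append, List.foldr_append]
  have h4 : (encVec (fun M : Fin I.m → Fin I.n → ℚ => encVec (encVec encRat) M) I.A).foldr readSymb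
      [(false, code I.b)] =
      [(false, code (α := Fin I.q → Fin I.m → Fin I.n → ℚ) I.A), (false, code I.b)] := h3 _ _
  rw [h4, readSymb_encNat, readSymb_encNat, readSymb_encNat]

namespace PolyTime

theorem readSymb : PolyTime fun x : Symb × List (Bool × SExpr) => readSymb x.1 x.2 := by
  have pairS : ∀ {α : Type} [Coded α] {f g : α → SExpr}, PolyTime f → PolyTime g →
      PolyTime fun a => SExpr.pair (f a) (g a) := fun hf hg =>
    (hf.pair hg).of_code (fun a => a) (fun _ => rfl) fun _ => rfl
  refine symb_cases fun s => ?_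
  cases s with
  | endNum => exact cons (const _) id
  | endList => exact cons (const _) id
  | bit b =>
    exact list_match (h := fun _ (x : Bool × SExpr) (s : List (Bool × SExpr)) =>
      (x.1, SExpr.pair (.atom (.bit b)) x.2) :: s) id nil
      (cons ((fst.comp (fst.comp snd)).pair (pairS (const_atom _) (snd.comp (fst.comp snd))))
        (snd.comp snd)) |>.of_eq fun s => by cases s <;> rfl
  | item =>
    refine list_match (h := fun _ (x : Bool × SExpr) (s : List (Bool × SExpr)) => match s with
      | [] => []
      | y :: s => if y.1 then
          match s with
          | [] => []
          | z :: s => (false, SExpr.pair (.pair x.2 y.2) z.2) :: s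
        else (false, .pair x.2 y.2) :: s) id nil ?_ |>.of_eq fun s => by
      rcases s with - | ⟨x, - | ⟨y, s⟩⟩ <;> rfl
    refine list_match (l := fun a : List (Bool × SExpr) × (Bool × SExpr) × List (Bool × SExpr) => a.2.2)
      (h := fun a (y : Bool × SExpr) (s : List (Bool × SExpr)) => if y.1 then
          match s with
          | [] => []
          | z :: s => (false, SExpr.pair (.pair a.2.1.2 y.2) z.2) :: s
        else (false, .pair a.2.1.2 y.2) :: s) (snd.comp snd) nil ?_ |>.of_eq fun a => by
      rcases a.2.2 with - | ⟨y, - | ⟨z, s⟩⟩ <;> rfl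
    have hx : PolyTime fun x : (List (Bool × SExpr) × (Bool × SExpr) × List (Bool × SExpr)) ×
        (Bool × SExpr) × List (Bool × SExpr) => x.1.2.1.2 :=
      snd.comp (fst.comp (snd.comp fst))
    have hy : PolyTime fun x : (List (Bool × SExpr) × (Bool × SExpr) × List (Bool × SExpr)) ×
        (Bool × SExpr) × List (Bool × SExpr) => x.2.1 := fst.comp snd
    refine ite (fst.comp hy) ?_ (cons ((const _).pair (pairS hx (snd.comp hy))) (snd.comp snd))
    refine list_match (h := fun a (z : Bool × SExpr) (s : List (Bool × SExpr)) => (false, SExpr.pair (.pair a.1.2.1.2 a.2.1.2) z.2) :: s)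
      (snd.comp snd) nil (cons ((const _).pair (pairS (pairS (hx.comp fst) (snd.comp (hy.comp fst)))
        (snd.comp (fst.comp snd)))) (snd.comp snd)) |>.of_eq fun a => ?_
    rcases a.2.2 with - | ⟨z, s⟩ <;> rfl
  | _ => exact id

theorem foldr_readSymb : PolyTime fun I : ARMInstance => (encARM I).foldr _root_.readSymb [] := by
  have h : PolyTime fun w : List Symb => w.foldr _root_.readSymb [] := by
    refine foldr_of_le (g := fun _ => []) (h := fun _ b s => _root_.readSymb b s) 4 id nil
      (readSymb.comp snd) ?_
    rintro - s l
    have hs : ∀ x : SExpr, codeSize x = x.size := fun _ => rfl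
    cases s with
    | bit b =>
      rcases l with - | ⟨⟨k, x⟩, l⟩
      · simp [_root_.readSymb]
      · simp [_root_.readSymb, hs]; omega
    | item =>
      rcases l with - | ⟨⟨k, x⟩, - | ⟨⟨_ | _, y⟩, - | ⟨⟨k', z⟩, l⟩⟩⟩ <;>
        simp [_root_.readSymb, hs] <;> omega
    | _ => simp [_root_.readSymb, hs] <;> omega
  exact h.of_code encARM (fun _ => rfl) fun _ => rfl

theorem armMatrices : PolyTime fun I : ARMInstance =>
    List.ofFn fun l => List.ofFn fun i => List.ofFn fun j => I.A l i j :=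
  (snd.comp (getD foldr_readSymb (false, .atom .endList) 3)).of_code (fun I => I) (fun _ => rfl)
    fun I => by
      rw [readSymb_encARM]
      exact code_ofFn (α := Fin I.m → Fin I.n → ℚ)
        (g := fun M => List.ofFn fun i => List.ofFn fun j => M i j)
        (fun M => code_ofFn (g := fun v => List.ofFn fun j => v j) (fun _ => rfl) M) I.A

theorem armRhs : PolyTime fun I : ARMInstance => List.ofFn I.b :=
  (snd.comp (getD foldr_readSymb (false, .atom .endList) 4)).of_code (fun I => I) (fun _ => rfl)
    fun I => by
      rw [readSymb_encARM]
      rfl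

theorem armCols : PolyTime fun I : ARMInstance => I.n :=
  (snd.comp (getD foldr_readSymb (false, .atom .endList) 1)).of_code (fun I => I) (fun _ => rfl)
    fun I => by
      rw [readSymb_encARM]
      rfl

end PolyTime

/-! ## The determinantal sentence and its computation -/

open Coded

/-- Rational numbers multiplied by a common denominator, together with this denominator. -/
def clearDenoms (l : List ℚ) : List ℤ × ℕ :=
  l.foldl (fun s r => (s.1.map (fun c => c * (r.den : ℤ)) ++ [r.num * (s.2 : ℤ)], s.2 * r.den))
    ([], 1)

theorem clearDenoms_append_singleton (l : List ℚ) (r : ℚ) : clearDenoms (l ++ [r]) =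
    ((clearDenoms l).1.map (fun c => c * (r.den : ℤ)) ++ [r.num * ((clearDenoms l).2 : ℤ)],
      (clearDenoms l).2 * r.den) := by
  simp [clearDenoms, List.foldl_append]

theorem clearDenoms_fst (l : List ℚ) :
    (clearDenoms l).1.map (fun c : ℤ => (c : ℚ)) =
      l.map fun r : ℚ => r * ((clearDenoms l).2 : ℚ) := by
  induction l using List.reverseRecOn with
  | nil => rfl
  | append_singleton l r ih =>
    rw [clearDenoms_append_singleton]
    simp only [List.map_append, List.map_map, List.map_cons, List.map_nil, Nat.cast_mul,
      Int.cast_mul, Int.cast_natCast]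
    congr 1
    · have := congrArg (List.map fun x : ℚ => x * r.den) ih
      rw [List.map_map, List.map_map] at this
      convert this using 2
      · funext c; simp
      · funext c; simp [mul_assoc]
    · rw [← Rat.mul_den_eq_num r, mul_assoc, mul_comm (r.den : ℚ)]

theorem clearDenoms_snd_pos (l : List ℚ) : 0 < (clearDenoms l).2 := by
  induction l using List.reverseRecOn with
  | nil => exact one_pos
  | append_singleton l r ih =>
    rw [clearDenoms_append_singleton]
    exact Nat.mul_pos ih r.den_pos

theorem length_clearDenoms_fst (l : List ℚ) : (clearDenoms l).1.length = l.length := by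
  simpa using congrArg List.length (clearDenoms_fst l)

/-- All ways to append an element of the second list to the first one, keeping what follows this
element. -/
def extendChoices (l : List (List ℕ × List ℕ)) : List (List ℕ × List ℕ) :=
  l.flatMap fun x => x.2.tails.flatMap fun t => match t with
    | [] => []
    | a :: r => [(x.1 ++ [a], r)]

/-- The sublists of length `4`. -/
def fourSublists (l : List ℕ) : List (List ℕ) :=
  (extendChoices (extendChoices (extendChoices (extendChoices [([], l)])))).map fun x => x.1

/-- The exponents, at the positions in `R`, of the product of the variables listed in `ps`. -/
def exponents (R ps : List ℕ) : List ℕ := R.map fun k => ps.count k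

/-- The terms of `⟨A, X⟩ - b`, multiplied by a common denominator. -/
def affineTerms (R : List ℕ) (A : List (List ℚ)) (b : ℚ) : List (ℤ × List ℕ) :=
  (clearDenoms (A.flatten ++ [-b])).1.zip (R.map (fun k => exponents R [k]) ++ [exponents R []])

/-- The terms of the minor with rows `r` and columns `c` of the matrix of indeterminates with `n`
columns. -/
noncomputable def minorTerms (R : List ℕ) (n : ℕ) (r c : List ℕ) : List (ℤ × List ℕ) :=
  (Finset.univ : Finset (Equiv.Perm (Fin 4))).toList.map fun σ : Equiv.Perm (Fin 4) =>
    ((Equiv.Perm.sign σ : ℤ), exponents R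
      ((List.finRange 4).map fun i : Fin 4 => c.getD (i : ℕ) 0 + n * r.getD (σ i : ℕ) 0))

/-- The terms of all minors. -/
noncomputable def allMinorTerms (R : List ℕ) (n : ℕ) (rows cols : List ℕ) :
    List (List (ℤ × List ℕ)) :=
  (fourSublists rows).flatMap fun r => (fourSublists cols).map fun c => minorTerms R n r c

/-- The word of a conjunction of equalities in the variables numbered by `R`. -/
def allZeroWord (R : List ℕ) (ps : List (List (ℤ × List ℕ))) : List Symb :=
  R.map (fun _ => Symb.var) ++ Symb.endList ::
    (ps.flatMap (fun p => Symb.and :: Symb.eqZero ::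
      encList (fun c => encInt c.1 ++ encList encNat c.2) p) ++ [Symb.eqZero, Symb.endList])

/-- The word of the determinantal sentence of the instance with matrices `As` and right-hand sides
`bs`. -/
noncomputable def determinantalWord (As : List (List (List ℚ))) (bs : List ℚ) (n : ℕ) :
    List Symb :=
  let R := List.range (As.headD []).flatten.length
  allZeroWord R ((As.zip bs).map (fun x => affineTerms R x.1 x.2) ++
    allMinorTerms R n (List.range (As.headD []).length)
      (List.range ((As.headD []).headD []).length))

namespace PolyTime

open Polynomial

variable {α β γ δ σ : Type} [Coded α] [Coded β] [Coded γ] [Coded δ] [Coded σ]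

theorem size_mul_le (m n : ℕ) : (m * n).size ≤ m.size + n.size := by
  rw [Nat.size_le, pow_add]
  exact Nat.mul_lt_mul'' (Nat.lt_size_self m) (Nat.lt_size_self n)

/-- The common denominator is the product of all denominators read so far, and its length is at most
about the sum of their lengths. The states of the fold therefore remain polynomial although all
numerators are rescaled in every round. -/
theorem clearDenoms {l : α → List ℚ} (hl : PolyTime l) : PolyTime fun a => clearDenoms (l a) := by
  obtain ⟨P, hP⟩ := hl.polySize
  have hrat : ∀ r : ℚ, codeSize r = codeSize r.num + codeSize r.den + 1 := fun r =>
    codeSize_prod r.num r.den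
  have hden : ∀ u : List ℚ, codeSize (_root_.clearDenoms u).2 ≤ codeSize u + 2 := by
    intro u
    induction u using List.reverseRecOn with
    | nil => rw [codeSize_nat]; simp [_root_.clearDenoms]
    | append_singleton u r ih =>
      have h1 := size_mul_le (_root_.clearDenoms u).2 r.den
      have h2 := codeSize_append u [r]
      have h3 := hrat r
      rw [clearDenoms_append_singleton]
      change codeSize ((_root_.clearDenoms u).2 * r.den) ≤ _
      rw [codeSize_nat] at ih h3 ⊢
      simp only [codeSize_cons, codeSize_nil] at h2
      omega
  have hnum : ∀ u : List ℚ, ∀ c ∈ (_root_.clearDenoms u).1, codeSize c ≤ 2 * codeSize u + 4 := by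
    intro u c hc
    have h1 : (c : ℚ) ∈ u.map fun r : ℚ => r * ((_root_.clearDenoms u).2 : ℚ) := by
      rw [← clearDenoms_fst]
      exact List.mem_map_of_mem hc
    obtain ⟨r, hr, hrc⟩ := List.mem_map.1 h1
    -- With `D` the common denominator, `c = r * D`; clearing `r.den`, which is at least 1, gives
    -- `|c| ≤ |r.num| * D`.
    have h2 : c * r.den = r.num * (_root_.clearDenoms u).2 := by
      have : (c : ℚ) * r.den = r.num * (_root_.clearDenoms u).2 := by
        rw [← hrc, ← Rat.mul_den_eq_num r]
        ring
      exact_mod_cast this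
    have h3 : c.natAbs ≤ r.num.natAbs * (_root_.clearDenoms u).2 := by
      have := congrArg Int.natAbs h2
      rw [Int.natAbs_mul, Int.natAbs_mul, Int.natAbs_natCast, Int.natAbs_natCast] at this
      exact this ▸ Nat.le_mul_of_pos_right _ r.den_pos
    have h4 := (Nat.size_le_size h3).trans (size_mul_le _ _)
    have h5 := hden u
    have h6 := codeSize_le_of_mem hr
    have h7 := hrat r
    rw [codeSize_int, codeSize_nat] at h7 ⊢
    rw [codeSize_nat] at h5
    omega
  have hstep : PolyTime fun x : α × (List ℤ × ℕ) × ℚ =>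
      (x.2.1.1.map (fun c => c * (x.2.2.den : ℤ)) ++ [x.2.2.num * (x.2.1.2 : ℤ)],
        x.2.1.2 * x.2.2.den) := by
    have hr : PolyTime fun x : α × (List ℤ × ℕ) × ℚ => x.2.2 := snd.comp snd
    have hD : PolyTime fun x : α × (List ℤ × ℕ) × ℚ => x.2.1.2 := snd.comp (fst.comp snd)
    have h1 : PolyTime fun x : α × (List ℤ × ℕ) × ℚ =>
        x.2.1.1.map (fun c => c * (x.2.2.den : ℤ)) :=
      map (f := fun (x : α × (List ℤ × ℕ) × ℚ) (c : ℤ) => c * (x.2.2.den : ℤ))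
        (fst.comp (fst.comp snd)) (intMulNat snd (ratDen (hr.comp fst)))
    have h2 : PolyTime fun x : α × (List ℤ × ℕ) × ℚ => x.2.2.num * (x.2.1.2 : ℤ) :=
      intMulNat (ratNum hr) hD
    have h3 : PolyTime fun x : α × (List ℤ × ℕ) × ℚ => x.2.1.2 * x.2.2.den :=
      natMul hD (ratDen hr)
    exact (append h1 (cons h2 nil)).pair h3
  refine foldl (g := fun _ => (([] : List ℤ), (1 : ℕ)))
    (h := fun _ (s : List ℤ × ℕ) (r : ℚ) =>
      (s.1.map (fun c => c * (r.den : ℤ)) ++ [r.num * (s.2 : ℤ)], s.2 * r.den)) hl (const _) hstep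
    ⟨P * (2 * P + 5) + P + 5, fun a u hu => ?_⟩
  · have hu' := (codeSize_sublist hu.sublist).trans (hP a)
    have h1 := codeSize_le_of_forall (hnum u)
    have h2 := hden u
    have h3 := length_lt_codeSize u
    have h4 : u.length * (2 * codeSize u + 4 + 1) ≤
        P.eval (codeSize a) * (2 * P.eval (codeSize a) + 5) :=
      Nat.mul_le_mul (by omega) (by omega)
    rw [length_clearDenoms_fst] at h1
    have h5 : codeSize (_root_.clearDenoms u) =
        codeSize (_root_.clearDenoms u).1 + codeSize (_root_.clearDenoms u).2 + 1 :=
      codeSize_prod _ _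
    refine h5.le.trans ?_
    simp only [eval_add, eval_mul, eval_ofNat]
    omega

/-- A fold over the first list that carries the unused part of the second list in its state. -/
theorem zip {l : α → List β} {l' : α → List γ} (hl : PolyTime l) (hl' : PolyTime l') :
    PolyTime fun a => (l a).zip (l' a) := by
  set step : List γ × List (β × γ) → β → List γ × List (β × γ) := fun s b => match s.1 with
    | [] => s
    | c :: r => (r, s.2 ++ [(b, c)]) with hstep
  have key : ∀ (u : List β) (v : List γ) (w : List (β × γ)),
      (u.foldl step (v, w)).2 = w ++ u.zip v := by
    intro u
    induction u with
    | nil => simp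
    | cons b u ih =>
      intro v w
      cases v with
      | nil => simpa [hstep] using ih [] w
      | cons c v =>
        rw [List.foldl_cons, show step (c :: v, w) b = (v, w ++ [(b, c)]) from rfl, ih]
        simp
  refine (snd.comp (foldl_of_le (h := fun _ => step) 2 hl (hl'.pair nil) ?_ ?_)).of_eq
    fun a => by rw [key, List.nil_append]
  · refine (list_match (l := fun x : α × (List γ × List (β × γ)) × β => x.2.1.1)
      (g := fun x => x.2.1) (h := fun x c r => (r, x.2.1.2 ++ [(x.2.2, c)]))
      (fst.comp (fst.comp snd)) (fst.comp snd) ((snd.comp snd).pair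
        (append (snd.comp (fst.comp (snd.comp fst)))
          (cons ((snd.comp (snd.comp fst)).pair (fst.comp snd)) nil)))).of_eq ?_
    rintro ⟨a, ⟨s, t⟩, b⟩
    cases s <;> rfl
  · rintro - ⟨s, t⟩ b
    cases s with
    | nil => simp [hstep]; omega
    | cons c r =>
      have := codeSize_append t [(b, c)]
      simp [hstep] at this ⊢
      omega

theorem tails {l : α → List β} (hl : PolyTime l) : PolyTime fun a => (l a).tails := by
  obtain ⟨P, hP⟩ := hl.polySize
  -- The head of the accumulator is the whole suffix treated so far, so the next longer suffix
  -- arises by a single cons.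
  have key : ∀ u : List β, u.foldr (fun b s => (b :: s.headD []) :: s) [[]] = u.tails := by
    intro u
    induction u with
    | nil => rfl
    | cons b u ih =>
      rw [List.foldr_cons, ih]
      cases u <;> simp
  refine (foldr (g := fun _ => [[]]) (h := fun _ b (s : List (List β)) => (b :: s.headD []) :: s)
    hl (const _) (cons (cons (fst.comp snd) (headD (snd.comp snd) nil)) (snd.comp snd))
    ⟨(P + 1) * (P + 1) + 1, fun a u hu => ?_⟩).of_eq fun a => (key _).symm
  have h1 := (codeSize_sublist hu.sublist).trans (hP a)
  have h2 := length_lt_codeSize u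
  have h3 : ∀ t ∈ u.tails, codeSize t ≤ P.eval (codeSize a) := fun t ht =>
    (codeSize_sublist ((List.mem_tails _ _).1 ht).sublist).trans h1
  rw [key]
  refine (codeSize_le_of_forall h3).trans ?_
  rw [List.length_tails]
  simp only [eval_add, eval_mul, eval_one]
  gcongr
  omega

theorem extendChoices {l : α → List (List ℕ × List ℕ)} (hl : PolyTime l) :
    PolyTime fun a => extendChoices (l a) := by
  refine flatMap hl (f := fun _ (x : List ℕ × List ℕ) => x.2.tails.flatMap fun t => match t with
    | [] => []
    | a :: r => [(x.1 ++ [a], r)]) ?_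
  refine flatMap (f := fun (y : α × (List ℕ × List ℕ)) (t : List ℕ) => match t with
    | [] => []
    | a :: r => [(y.2.1 ++ [a], r)]) (tails (snd.comp snd)) ?_
  refine (list_match (h := fun (x : (α × (List ℕ × List ℕ)) × List ℕ) a r =>
    [(x.1.2.1 ++ [a], r)]) snd nil
    (cons ((append (fst.comp (snd.comp (fst.comp fst))) (cons (fst.comp snd) nil)).pair
      (snd.comp snd)) nil)).of_eq fun x => ?_
  cases x.2 <;> rfl

/-- A composition of four extensions, each polynomial; the number of compositions does not depend on
the input, so the result stays polynomial. -/
theorem fourSublists {l : α → List ℕ} (hl : PolyTime l) : PolyTime fun a => fourSublists (l a) :=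
  map (f := fun _ (x : List ℕ × List ℕ) => x.1) (extendChoices (extendChoices (extendChoices
    (extendChoices (cons (nil.pair hl) nil))))) (fst.comp snd)

theorem exponents {R ps : α → List ℕ} (hR : PolyTime R) (hp : PolyTime ps) :
    PolyTime fun a => exponents (R a) (ps a) :=
  map (f := fun a k => (ps a).count k) hR (count (hp.comp fst) snd)

theorem ratNeg {f : α → ℚ} (hf : PolyTime f) : PolyTime fun a => -f a :=
  ((intNeg (ratNum hf)).pair (ratDen hf)).of_code (fun a => a) (fun _ => rfl) fun _ => rfl

theorem affineTerms {R : α → List ℕ} {A : α → List (List ℚ)} {b : α → ℚ} (hR : PolyTime R)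
    (hA : PolyTime A) (hb : PolyTime b) : PolyTime fun a => affineTerms (R a) (A a) (b a) :=
  zip (fst.comp (clearDenoms (append (flatten hA) (cons (ratNeg hb) nil))))
    (append (map (f := fun a k => _root_.exponents (R a) [k]) hR
      (exponents (hR.comp fst) (cons snd nil))) (cons (exponents hR nil) nil))

/-- The 24 permutations and their signs are built into the program. Any order of them will do, so
the noncomputable choice of a list is harmless. -/
theorem minorTerms {R r c : α → List ℕ} {n : α → ℕ} (hR : PolyTime R) (hn : PolyTime n)
    (hr : PolyTime r) (hc : PolyTime c) : PolyTime fun a => minorTerms (R a) (n a) (r a) (c a) :=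
  map_const _ (F := fun (σ : Equiv.Perm (Fin 4)) a => ((Equiv.Perm.sign σ : ℤ),
    _root_.exponents (R a) ((List.finRange 4).map fun i : Fin 4 =>
      (c a).getD (i : ℕ) 0 + n a * (r a).getD (σ i : ℕ) 0))) fun σ =>
    (const _).pair (exponents hR (map_const _ fun i =>
      natAdd (getD hc 0 i) (natMul hn (getD hr 0 (σ i)))))

theorem allMinorTerms {R rows cols : α → List ℕ} {n : α → ℕ} (hR : PolyTime R) (hn : PolyTime n)
    (hr : PolyTime rows) (hc : PolyTime cols) :
    PolyTime fun a => allMinorTerms (R a) (n a) (rows a) (cols a) := by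
  refine flatMap (f := fun a r => (_root_.fourSublists (cols a)).map fun c =>
    _root_.minorTerms (R a) (n a) r c) (fourSublists hr) ?_
  exact map (f := fun (x : α × List ℕ) c => _root_.minorTerms (R x.1) (n x.1) x.2 c)
    (fourSublists (hc.comp fst)) (minorTerms (hR.comp (fst.comp fst)) (hn.comp (fst.comp fst))
      (snd.comp fst) snd)

theorem allZeroWord {R : α → List ℕ} {ps : α → List (List (ℤ × List ℕ))} (hR : PolyTime R)
    (hp : PolyTime ps) : PolyTime fun a => allZeroWord (R a) (ps a) := by
  have h1 : PolyTime fun c : ℤ × List ℕ => _root_.encInt c.1 ++ _root_.encList _root_.encNat c.2 :=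
    append (encInt fst) (encList snd (encNat id))
  refine append (map (f := fun _ _ => Symb.var) hR (const _)) (cons (const _) (append
    (flatMap (f := fun _ p => Symb.and :: Symb.eqZero :: _root_.encList _ p) hp
      (cons (const _) (cons (const _) (encList snd h1)))) (const _)))

theorem determinantalWord {As : α → List (List (List ℚ))} {bs : α → List ℚ} {n : α → ℕ}
    (hA : PolyTime As) (hb : PolyTime bs) (hn : PolyTime n) :
    PolyTime fun a => determinantalWord (As a) (bs a) (n a) := by
  have h1 := headD hA nil
  have hR := range_length (flatten h1)
  refine allZeroWord hR (append (map (f := fun a (x : List (List ℚ) × ℚ) =>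
    _root_.affineTerms (List.range ((As a).headD []).flatten.length) x.1 x.2) (zip hA hb)
      (affineTerms (hR.comp fst) (fst.comp snd) (snd.comp snd)))
    (allMinorTerms hR hn (range_length h1) (range_length (headD h1 nil))))

end PolyTime

/-! ## Correctness of the determinantal sentence -/

theorem mem_extendChoices {l : List (List ℕ × List ℕ)} {w r : List ℕ} :
    (w, r) ∈ extendChoices l ↔ ∃ u a t, w = u ++ [a] ∧ (u, t) ∈ l ∧ (a :: r) <:+ t := by
  simp only [extendChoices, List.mem_flatMap, Prod.exists, List.mem_tails]
  constructor
  · rintro ⟨u, t, hut, s, hs, h⟩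
    cases s with
    | nil => simp at h
    | cons a r' =>
      simp only [List.mem_singleton, Prod.mk.injEq] at h
      obtain ⟨rfl, rfl⟩ := h
      exact ⟨u, a, t, rfl, hut, hs⟩
  · rintro ⟨u, a, t, rfl, hut, hs⟩
    exact ⟨u, t, hut, a :: r, hs, by simp⟩

/-- Two invariants of an extension: a chosen part followed by its remainder is a sublist of `l`, and
every sublist continuing a chosen part still finds its continuation inside some remainder. -/
theorem mem_fourSublists {l w : List ℕ} : w ∈ fourSublists l ↔ w.Sublist l ∧ w.length = 4 := by
  have sound : ∀ (k : ℕ) (L : List (List ℕ × List ℕ)),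
      (∀ u t, (u, t) ∈ L → (u ++ t).Sublist l ∧ u.length = k) →
      ∀ u t, (u, t) ∈ extendChoices L → (u ++ t).Sublist l ∧ u.length = k + 1 := by
    intro k L hL u t h
    obtain ⟨u, a, t', rfl, hut, hs⟩ := mem_extendChoices.1 h
    obtain ⟨h1, h2⟩ := hL u t' hut
    refine ⟨?_, by simp [h2]⟩
    rw [List.append_assoc]
    exact ((List.append_sublist_append_left u).2 hs.sublist).trans h1
  have complete : ∀ (k : ℕ) (L : List (List ℕ × List ℕ)),
      (∀ u v, (u ++ v).Sublist l → u.length = k → ∃ t, (u, t) ∈ L ∧ v.Sublist t) →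
      ∀ u v, (u ++ v).Sublist l → u.length = k + 1 → ∃ t, (u, t) ∈ extendChoices L ∧ v.Sublist t := by
    intro k L hL u v h hu
    obtain ⟨u, a, rfl⟩ := List.eq_nil_or_concat' u |>.resolve_left (by rintro rfl; simp at hu)
    rw [List.append_assoc] at h
    obtain ⟨t, hut, ht⟩ := hL u (a :: v) h (by simpa using hu)
    -- Splitting the remainder so that `a` lies in the first piece and `v` is a sublist of the
    -- second; what follows `a` then still contains `v`.
    obtain ⟨r₁, r₂, rfl, ha, hv⟩ := List.cons_sublist_iff.1 ht
    obtain ⟨p, q, rfl⟩ := List.append_of_mem ha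
    refine ⟨q ++ r₂, mem_extendChoices.2 ⟨u, a, _, rfl, hut, ⟨p, by simp⟩⟩, ?_⟩
    exact hv.trans (List.sublist_append_right q r₂)
  simp only [fourSublists, List.mem_map, Prod.exists, exists_and_right, exists_eq_right]
  constructor
  · rintro ⟨t, h⟩
    have := sound 3 _ (sound 2 _ (sound 1 _ (sound 0 [([], l)] (by simp)))) w t h
    exact ⟨(List.sublist_append_left w t).trans this.1, this.2⟩
  · rintro ⟨h, hw⟩
    obtain ⟨t, h, -⟩ := complete 3 _ (complete 2 _ (complete 1 _ (complete 0 [([], l)] (by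
      intro u v h hu
      obtain rfl := List.length_eq_zero_iff.1 hu
      exact ⟨l, by simp, by simpa using h⟩)))) w [] (by simpa using h) hw
    exact ⟨t, h⟩

/-- In `List.range m` values and positions agree, so the order embedding of positions given by a
sublist is the row or column selection itself. -/
theorem mem_fourSublists_range {m : ℕ} {w : List ℕ} :
    w ∈ fourSublists (List.range m) ↔ ∃ r : Fin 4 ↪o Fin m, w = List.ofFn fun i => (r i : ℕ) := by
  rw [mem_fourSublists]
  constructor
  · rintro ⟨h, hw⟩
    obtain ⟨f, hf⟩ := List.sublist_iff_exists_fin_orderEmbedding_get_eq.1 h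
    refine ⟨(Fin.castOrderIso hw.symm).toOrderEmbedding.trans
      (f.trans (Fin.castOrderIso List.length_range).toOrderEmbedding), ?_⟩
    refine List.ext_get (by simp [hw]) fun k h1 h2 => ?_
    rw [hf ⟨k, h1⟩, List.get_ofFn, List.get_eq_getElem, List.getElem_range]
    rfl
  · rintro ⟨r, rfl⟩
    refine ⟨List.sublist_iff_exists_fin_orderEmbedding_get_eq.2
      ⟨(Fin.castOrderIso (by simp)).toOrderEmbedding.trans (r.trans
        (Fin.castOrderIso List.length_range.symm).toOrderEmbedding), fun k => ?_⟩, by simp⟩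
    rw [List.get_ofFn, List.get_eq_getElem, List.getElem_range]
    rfl

theorem headD_ofFn {α : Type} {n : ℕ} (hn : 0 < n) (v : Fin n → α) (d : α) :
    (List.ofFn v).headD d = v ⟨0, hn⟩ := by
  obtain ⟨n, rfl⟩ := Nat.exists_eq_succ_of_ne_zero hn.ne'
  rw [List.ofFn_succ]
  rfl

/-! ### Sentences given by lists of terms, and their words -/

/-- The sparse form with exponent vectors of length `N` given as lists. -/
def sparseOfTerms (N : ℕ) (p : List (ℤ × List ℕ)) : SparsePoly N :=
  p.map fun c => (c.1, fun k => c.2.getD k 0)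

/-- The length condition ensures that the default 0 is never used and nothing is cut off, so both
sides write the same exponents. -/
theorem encPoly_sparseOfTerms {N : ℕ} {p : List (ℤ × List ℕ)} (hp : ∀ c ∈ p, c.2.length = N) :
    encPoly (sparseOfTerms N p) = encList (fun c => encInt c.1 ++ encList encNat c.2) p := by
  induction p with
  | nil => rfl
  | cons c p ih =>
    have ih := ih fun d hd => hp d (by simp [hd])
    have hc : List.ofFn (fun k : Fin N => c.2.getD k 0) = c.2 := by
      have := hp c (by simp)
      subst this
      refine List.ext_getElem (by simp) fun i h1 h2 => ?_
      simp
    simp only [encPoly, sparseOfTerms, List.map_cons, encList, encVec] at ih ⊢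
    rw [hc, ih]

theorem length_exponents (R ps : List ℕ) : (exponents R ps).length = R.length := by
  simp [exponents]

theorem length_of_mem_affineTerms {R : List ℕ} {A : List (List ℚ)} {b : ℚ} {c : ℤ × List ℕ}
    (hc : c ∈ affineTerms R A b) : c.2.length = R.length := by
  have h := (List.of_mem_zip (a := c.1) (b := c.2) hc).2
  simp only [List.mem_append, List.mem_map, List.mem_singleton] at h
  rcases h with ⟨k, -, h⟩ | h
  · rw [← h, length_exponents]
  · rw [h, length_exponents]

theorem length_of_mem_minorTerms {R : List ℕ} {n : ℕ} {r c' : List ℕ} {c : ℤ × List ℕ}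
    (hc : c ∈ minorTerms R n r c') : c.2.length = R.length := by
  obtain ⟨σ, -, rfl⟩ := List.mem_map.1 hc
  exact length_exponents _ _

theorem encFormula_allZero {N : ℕ} (ps : List (SparsePoly N)) :
    encFormula (QFFormula.allZero ps) =
      ps.flatMap (fun p => Symb.and :: Symb.eqZero :: encPoly p) ++ [Symb.eqZero, Symb.endList] := by
  induction ps with
  | nil => rfl
  | cons p ps ih => simp [QFFormula.allZero, encFormula, ih]

theorem encSentence_allZero {N : ℕ} {ps : List (List (ℤ × List ℕ))}
    (hps : ∀ p ∈ ps, ∀ c ∈ p, c.2.length = N) :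
    encSentence ⟨N, QFFormula.allZero (ps.map (sparseOfTerms N))⟩ =
      allZeroWord (List.range N) ps := by
  have h : ∀ ps : List (List (ℤ × List ℕ)), (∀ p ∈ ps, ∀ c ∈ p, c.2.length = N) →
      (ps.map (sparseOfTerms N)).flatMap (fun p => Symb.and :: Symb.eqZero :: encPoly p) =
      ps.flatMap (fun p => Symb.and :: Symb.eqZero ::
        encList (fun c => encInt c.1 ++ encList encNat c.2) p) := by
    intro ps hps
    induction ps with
    | nil => rfl
    | cons p ps ih =>
      have ih := ih fun q hq => hps q (by simp [hq])
      have hp := encPoly_sparseOfTerms (hps p (by simp))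
      simp only [List.map_cons, List.flatMap_cons, ih, hp]
  rw [encSentence, encFormula_allZero, allZeroWord, h ps hps]
  simp [List.map_const']

namespace ARMInstance

variable (I : ARMInstance)

/-- The rows of a matrix. -/
def matrixRows (l : Fin I.q) : List (List ℚ) := List.ofFn fun i => List.ofFn fun j => I.A l i j

/-- The term lists of the determinantal sentence of an instance. -/
noncomputable def sentenceTerms : List (List (ℤ × List ℕ)) :=
  (List.ofFn fun l => affineTerms (List.range (I.m * I.n)) (I.matrixRows l) (I.b l)) ++
    allMinorTerms (List.range (I.m * I.n)) I.n (List.range I.m) (List.range I.n)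

/-- The determinantal sentence of an instance; without constraints, a trivial sentence. -/
noncomputable def sentence : ETRSentence :=
  if I.q = 0 then ⟨0, QFFormula.allZero []⟩
  else ⟨I.m * I.n, QFFormula.allZero (I.sentenceTerms.map (sparseOfTerms (I.m * I.n)))⟩

theorem length_of_mem_sentenceTerms {p : List (ℤ × List ℕ)} (hp : p ∈ I.sentenceTerms)
    {c : ℤ × List ℕ} (hc : c ∈ p) : c.2.length = I.m * I.n := by
  rw [← List.length_range (n := I.m * I.n)]
  rcases List.mem_append.1 hp with h | h
  · obtain ⟨l, rfl⟩ := List.mem_ofFn.1 h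
    exact length_of_mem_affineTerms hc
  · simp only [allMinorTerms, List.mem_flatMap, List.mem_map] at h
    obtain ⟨r, -, c', -, rfl⟩ := h
    exact length_of_mem_minorTerms hc

theorem length_flatten_matrixRows (l : Fin I.q) : (I.matrixRows l).flatten.length = I.m * I.n := by
  simp [matrixRows, List.length_flatten, Function.comp_def, List.map_ofFn]

/-- The program reads the shape of the matrices off the first one. If there is none, all index
ranges come out empty and the same expression yields the word of the trivial sentence, so the
program needs no test for `q = 0`. -/
theorem encSentence_sentence :
    encSentence I.sentence = determinantalWord (List.ofFn I.matrixRows) (List.ofFn I.b) I.n := by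
  by_cases hq : I.q = 0
  · obtain ⟨m, n, q, A, b⟩ := I
    subst hq
    have h := encSentence_allZero (N := 0) (ps := []) (by simp)
    rw [sentence, if_pos rfl]
    refine h.trans ?_
    simp [determinantalWord, allMinorTerms, fourSublists, extendChoices]
  · rw [sentence, if_neg hq, encSentence_allZero fun p hp c hc =>
      I.length_of_mem_sentenceTerms hp hc, determinantalWord]
    have h0 : (List.ofFn I.matrixRows).headD [] = I.matrixRows ⟨0, Nat.pos_of_ne_zero hq⟩ := by
      exact headD_ofFn _ _ _
    have h1 : (I.matrixRows ⟨0, Nat.pos_of_ne_zero hq⟩).length = I.m := by simp [matrixRows]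
    have h2 : (List.ofFn I.matrixRows).zip (List.ofFn I.b) =
        List.ofFn fun l => (I.matrixRows l, I.b l) := by
      refine List.ext_getElem (by simp) fun i h1 h2 => by simp
    rw [h0, h1, length_flatten_matrixRows, h2, List.map_ofFn]
    rw [sentenceTerms]
    congr 2
    -- Without rows there is no first row from which to read `n`, and the column range comes out
    -- empty. This does not matter, as there are no four rows to choose.
    rcases Nat.eq_zero_or_pos I.m with hm | hm
    · rw [hm]
      rfl
    · have h3 : ((I.matrixRows ⟨0, Nat.pos_of_ne_zero hq⟩).headD []).length = I.n := by
        rw [matrixRows, headD_ofFn hm, List.length_ofFn]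
      rw [h3]

theorem polyTime_sentence : PolyTimeComputable (ARM 3) ETR sentence := by
  obtain ⟨p, T, hp⟩ := PolyTime.determinantalWord PolyTime.armMatrices PolyTime.armRhs
    PolyTime.armCols
  refine tm2ComputableInPolyTime_of_computes (ea := encARM) (eb := encSentence) (f := sentence)
    p T fun I => ?_
  rw [encSentence_sentence]
  exact hp I

end ARMInstance

/-! ### Polynomials denoted by the lists of terms -/

open MvPolynomial

/-- The exponent vector with entries `e.getD k 0`. -/
noncomputable def expFinsupp (N : ℕ) (e : List ℕ) : Fin N →₀ ℕ :=
  Finsupp.equivFunOnFinite.symm fun k => e.getD k 0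

theorem toMvPolynomial_sparseOfTerms (N : ℕ) (p : List (ℤ × List ℕ)) :
    (sparseOfTerms N p).toMvPolynomial = (p.map fun c => monomial (expFinsupp N c.2) c.1).sum := by
  rw [SparsePoly.toMvPolynomial, sparseOfTerms, List.map_map]
  rfl

theorem expFinsupp_exponents (N : ℕ) (ps : List ℕ) (k : Fin N) :
    expFinsupp N (exponents (List.range N) ps) k = ps.count (k : ℕ) := by
  simp [expFinsupp, exponents]

theorem expFinsupp_singleton {N : ℕ} (k : Fin N) :
    expFinsupp N (exponents (List.range N) [(k : ℕ)]) = Finsupp.single k 1 := by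
  ext j
  rw [expFinsupp_exponents, Finsupp.single_apply, List.count_singleton]
  simp [Fin.ext_iff]

theorem expFinsupp_nil (N : ℕ) : expFinsupp N (exponents (List.range N) []) = 0 := by
  ext j
  rw [expFinsupp_exponents]
  simp

theorem getD_ofFn {α : Type} {n : ℕ} (v : Fin n → α) (i : Fin n) (d : α) :
    (List.ofFn v).getD i d = v i := by
  simp

theorem count_map_val {α : Type} {N : ℕ} (f : α → Fin N) (k : Fin N) (l : List α) :
    (l.map fun i => (f i : ℕ)).count (k : ℕ) = (l.map fun i => Finsupp.single (f i) 1 k).sum := by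
  induction l with
  | nil => rfl
  | cons a l ih =>
    rw [List.map_cons, List.count_cons, ih, List.map_cons, List.sum_cons, add_comm,
      Finsupp.single_apply]
    simp only [beq_iff_eq, Fin.val_inj]

/-- This is the Leibniz formula: the product belonging to a permutation is a monomial whose
exponents count how often each variable occurs, and `c + n * r` is the number that `finProdFinEquiv`
gives to the entry `(r, c)`. -/
theorem toMvPolynomial_minorTerms {m n : ℕ} (r : Fin 4 ↪o Fin m) (c : Fin 4 ↪o Fin n) :
    (sparseOfTerms (m * n) (minorTerms (List.range (m * n)) n (List.ofFn fun i => (r i : ℕ))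
      (List.ofFn fun i => (c i : ℕ)))).toMvPolynomial = minorPoly r c := by
  rw [toMvPolynomial_sparseOfTerms, minorTerms, List.map_map, Finset.sum_map_toList, minorPoly,
    Matrix.det_apply']
  refine Finset.sum_congr rfl fun σ _ => ?_
  have h : expFinsupp (m * n) (exponents (List.range (m * n)) ((List.finRange 4).map
      fun i : Fin 4 => (List.ofFn fun i => (c i : ℕ)).getD (i : ℕ) 0 +
        n * (List.ofFn fun i => (r i : ℕ)).getD (σ i : ℕ) 0)) =
      ∑ i, Finsupp.single (finProdFinEquiv (r (σ i), c i)) 1 := by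
    have hg : ((List.finRange 4).map fun i : Fin 4 =>
        (List.ofFn fun i => (c i : ℕ)).getD (i : ℕ) 0 +
          n * (List.ofFn fun i => (r i : ℕ)).getD (σ i : ℕ) 0) =
        (List.finRange 4).map fun i => (finProdFinEquiv (r (σ i), c i) : ℕ) := by
      refine List.map_congr_left fun i _ => ?_
      rw [finProdFinEquiv_apply_val, getD_ofFn, getD_ofFn]
    ext k
    rw [hg, expFinsupp_exponents, Finsupp.finsetSum_apply, count_map_val, Fin.sum_univ_def]
  simp only [Function.comp_apply, h, genericMatrix, Matrix.submatrix_apply, Matrix.of_apply]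
  rw [monomial_sum_index]
  rfl

theorem sum_map_zip_ofFn {N : ℕ} {α β M : Type} [AddCommMonoid M] (u : Fin N → α) (v : Fin N → β)
    (F : α × β → M) : (((List.ofFn u).zip (List.ofFn v)).map F).sum = ∑ k, F (u k, v k) := by
  have h : (List.ofFn u).zip (List.ofFn v) = List.ofFn fun k => (u k, v k) :=
    List.ext_getElem (by simp) fun i h1 h2 => by simp
  rw [h, List.map_ofFn, List.sum_ofFn]
  rfl

namespace ARMInstance

variable (I : ARMInstance)

theorem flatten_matrixRows (l : Fin I.q) : (I.matrixRows l).flatten =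
    List.ofFn fun k : Fin (I.m * I.n) =>
      I.A l (finProdFinEquiv.symm k).1 (finProdFinEquiv.symm k).2 := by
  rw [List.ofFn_mul, matrixRows]
  refine congrArg _ (congrArg _ (funext fun i => congrArg _ (funext fun j => ?_)))
  have h : finProdFinEquiv.symm (⟨i * I.n + j, by
      calc (i : ℕ) * I.n + j < (i + 1) * I.n := by rw [add_mul, one_mul]; omega
        _ ≤ _ := Nat.mul_le_mul_right _ i.prop⟩ : Fin (I.m * I.n)) = (i, j) := by
    rw [Equiv.symm_apply_eq]
    exact Fin.ext (by simp [mul_comm, add_comm])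
  rw [h]

/-- Flattening by rows lists the coefficients in the numbering of the variables. The constant `-b`
is cleared along with them and is the last term, with exponent vector 0. -/
theorem map_affineTerms (l : Fin I.q) :
    MvPolynomial.map (Int.castRingHom ℚ) (sparseOfTerms (I.m * I.n)
      (affineTerms (List.range (I.m * I.n)) (I.matrixRows l) (I.b l))).toMvPolynomial =
      (((clearDenoms ((I.matrixRows l).flatten ++ [-I.b l])).2 : ℕ) : ℚ) • I.affinePoly l := by
  set D := (clearDenoms ((I.matrixRows l).flatten ++ [-I.b l])).2 with hD
  rw [toMvPolynomial_sparseOfTerms, map_list_sum, List.map_map]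
  have h1 : ∀ (cs : List ℤ) (es : List (List ℕ)),
      (cs.zip es).map (MvPolynomial.map (Int.castRingHom ℚ) ∘ fun c =>
        monomial (expFinsupp (I.m * I.n) c.2) c.1) =
      ((cs.map fun c : ℤ => (c : ℚ)).zip es).map fun c => monomial (expFinsupp (I.m * I.n) c.2) c.1 := by
    intro cs es
    rw [List.zip_map_left, List.map_map]
    refine List.map_congr_left fun c _ => ?_
    simp [MvPolynomial.map_monomial]
  have h2 : (List.range (I.m * I.n)).map (fun k => exponents (List.range (I.m * I.n)) [k]) =
      List.ofFn fun k : Fin (I.m * I.n) => exponents (List.range (I.m * I.n)) [(k : ℕ)] :=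
    List.ext_getElem (by simp) fun i h1 h2 => by simp
  rw [affineTerms, h1, clearDenoms_fst, ← hD, List.map_append, flatten_matrixRows, List.map_ofFn,
    h2, List.zip_append (by simp), List.map_append, List.sum_append, sum_map_zip_ofFn]
  simp only [Function.comp_apply, expFinsupp_singleton, List.map_cons, List.map_nil,
    List.zip_cons_cons, List.zip_nil_right, List.sum_cons, List.sum_nil, expFinsupp_nil, add_zero]
  rw [affinePoly, smul_sub, ← Fintype.sum_prod_type', ← finProdFinEquiv.symm.sum_comp,
    Finset.smul_sum, sub_eq_add_neg]
  congr 1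
  · refine Finset.sum_congr rfl fun k _ => ?_
    rw [genericMatrix, Matrix.of_apply, Prod.mk.eta, Equiv.apply_symm_apply,
      C_mul_X_eq_monomial, smul_monomial, smul_eq_mul]
    exact congrArg _ (mul_comm _ _)
  · rw [neg_mul, map_neg, mul_comm (I.b l), smul_eq_C_mul, ← C_mul]
    rfl

theorem isDeterminantalSentence_sentence (hq : 0 < I.q) : I.IsDeterminantalSentence I.sentence := by
  refine ⟨fun l => sparseOfTerms _ (affineTerms (List.range (I.m * I.n)) (I.matrixRows l) (I.b l)),
    (allMinorTerms (List.range (I.m * I.n)) I.n (List.range I.m) (List.range I.n)).map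
      (sparseOfTerms _), ?_, fun l => ⟨_, clearDenoms_snd_pos _, I.map_affineTerms l⟩, ?_, ?_⟩
  · rw [sentence, if_neg hq.ne', sentenceTerms, List.map_append, List.map_ofFn]
    rfl
  · intro p hp
    simp only [allMinorTerms, List.mem_map, List.mem_flatMap] at hp
    obtain ⟨-, ⟨r, hr, c, hc, rfl⟩, rfl⟩ := hp
    obtain ⟨r, rfl⟩ := mem_fourSublists_range.1 hr
    obtain ⟨c, rfl⟩ := mem_fourSublists_range.1 hc
    refine ⟨?_, r, c, toMvPolynomial_minorTerms r c⟩
    simp only [sparseOfTerms, minorTerms, List.length_map, Finset.length_toList, Finset.card_univ,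
      Fintype.card_perm, Fintype.card_fin]
    rfl
  · intro r c
    refine ⟨_, List.mem_map_of_mem ?_, toMvPolynomial_minorTerms r c⟩
    simp only [allMinorTerms, List.mem_map, List.mem_flatMap]
    exact ⟨_, mem_fourSublists_range.2 ⟨r, rfl⟩, _, mem_fourSublists_range.2 ⟨c, rfl⟩, rfl⟩

end ARMInstance

/-! ### Truth over the reals: rank and minors -/

theorem QFFormula.holds_allZero {N : ℕ} (x : Fin N → ℝ) (ps : List (SparsePoly N)) :
    (QFFormula.allZero ps).Holds x ↔ ∀ p ∈ ps, aeval x p.toMvPolynomial = 0 := by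
  induction ps with
  | nil => simp [allZero, Holds, SparsePoly.toMvPolynomial]
  | cons p ps ih => simp [allZero, Holds, ih]

/-- A maximal independent family of rows has `X.rank` members; `k` of their indices, put in
increasing order, give the embedding. -/
theorem Matrix.exists_linearIndependent_rows {m n k : ℕ} {X : Matrix (Fin m) (Fin n) ℝ}
    (h : k ≤ X.rank) :
    ∃ r : Fin k ↪o Fin m, LinearIndependent ℝ (X.submatrix r id).row := by
  obtain ⟨κ, a, ha, hspan, hli⟩ := exists_linearIndependent' ℝ X.row
  have : Fintype κ := Fintype.ofInjective a ha
  have hcard : k ≤ (Finset.univ.map ⟨a, ha⟩).card := by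
    rw [Finset.card_map, Finset.card_univ, linearIndependent_iff_card_eq_finrank_span.1 hli,
      Set.finrank, hspan, ← Matrix.rank_eq_finrank_span_row]
    exact h
  obtain ⟨T, hT, hTk⟩ := Finset.exists_subset_card_eq hcard
  refine ⟨T.orderEmbOfFin hTk, ?_⟩
  have hmem : ∀ i, ∃ j, a j = T.orderEmbOfFin hTk i := by
    intro i
    simpa using hT (T.orderEmbOfFin_mem hTk i)
  choose g hg using hmem
  have hginj : Function.Injective g := fun i j hij => by
    have := congrArg a hij
    rw [hg, hg] at this
    exact (T.orderEmbOfFin hTk).injective this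
  have hrow : (X.submatrix (T.orderEmbOfFin hTk) id).row = (X.row ∘ a) ∘ g := by
    funext i
    simp only [Function.comp_apply, hg]
    rfl
  rw [hrow]
  exact hli.comp g hginj

/-- Rows are selected first. The resulting `k`-rowed matrix has rank `k`, so the same selection
applied to its transpose finds the columns and leaves an invertible square matrix. -/
theorem Matrix.exists_det_submatrix_ne_zero {m n k : ℕ} {X : Matrix (Fin m) (Fin n) ℝ}
    (h : k ≤ X.rank) :
    ∃ (r : Fin k ↪o Fin m) (c : Fin k ↪o Fin n), (X.submatrix r c).det ≠ 0 := by
  obtain ⟨r, hr⟩ := Matrix.exists_linearIndependent_rows h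
  have h1 : k ≤ (X.submatrix r id).transpose.rank := by
    rw [Matrix.rank_transpose, hr.rank_matrix, Fintype.card_fin]
  obtain ⟨c, hc⟩ := Matrix.exists_linearIndependent_rows h1
  refine ⟨r, c, ?_⟩
  have h2 := (Matrix.isUnit_iff_isUnit_det _).1 (Matrix.linearIndependent_rows_iff_isUnit.1 hc)
  rw [← Matrix.det_transpose]
  exact h2.ne_zero

theorem Matrix.rank_le_three_iff {m n : ℕ} (X : Matrix (Fin m) (Fin n) ℝ) :
    X.rank ≤ 3 ↔ ∀ (r : Fin 4 ↪o Fin m) (c : Fin 4 ↪o Fin n), (X.submatrix r c).det = 0 := by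
  constructor
  · intro h r c
    by_contra hdet
    have h1 : (X.submatrix r c).rank = 4 := by
      rw [Matrix.rank_of_isUnit _ ((Matrix.isUnit_iff_isUnit_det _).2 (isUnit_iff_ne_zero.2 hdet))]
      simp
    have h2 := Matrix.rank_submatrix_le X r c
    omega
  · intro h
    by_contra hX
    obtain ⟨r, c, hrc⟩ := Matrix.exists_det_submatrix_ne_zero (k := 4) (not_le.1 hX)
    exact hrc (h r c)

/-- Points and matrices correspond through `finProdFinEquiv`. Under this correspondence the positive
factors `d` cancel from the affine equations, and the remaining equations say that all 4 × 4 minors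
vanish. -/
theorem ARMInstance.IsDeterminantalSentence.isTrue_iff {I : ARMInstance} {S : ETRSentence}
    (hS : I.IsDeterminantalSentence S) : S.IsTrue ↔ ∃ X, I.IsSolution 3 X := by
  obtain ⟨affine, minors, rfl, ha, hm, hm'⟩ := hS
  set mat : (Fin (I.m * I.n) → ℝ) → Matrix (Fin I.m) (Fin I.n) ℝ := fun x =>
    Matrix.of fun i j => x (finProdFinEquiv (i, j)) with hmat
  have key : ∀ x : Fin (I.m * I.n) → ℝ,
      (QFFormula.allZero (List.ofFn affine ++ minors)).Holds x ↔ I.IsSolution 3 (mat x) := by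
    intro x
    have h1 : ∀ l, aeval x (affine l).toMvPolynomial = 0 ↔
        ∑ i, ∑ j, (I.A l i j : ℝ) * mat x i j = (I.b l : ℝ) := by
      intro l
      obtain ⟨d, hd, h⟩ := ha l
      have h2 := congrArg (aeval x) h
      rw [show Int.castRingHom ℚ = algebraMap ℤ ℚ from rfl, aeval_map_algebraMap] at h2
      rw [h2, map_smul, affinePoly]
      simp only [genericMatrix, Matrix.of_apply, map_sub, map_sum, map_mul, aeval_X, aeval_C,
        hmat, eq_ratCast]
      rw [smul_eq_zero, sub_eq_zero]
      simp [hd.ne']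
    have h2 : ∀ r c, aeval x (minorPoly r c) = ((mat x).submatrix r c).det := by
      intro r c
      rw [minorPoly, AlgHom.map_det]
      congr 1
      ext i j
      simp [genericMatrix, hmat]
    rw [QFFormula.holds_allZero, IsSolution, Matrix.rank_le_three_iff]
    simp only [List.mem_append, or_imp, forall_and, List.mem_ofFn,
      forall_exists_index, forall_apply_eq_imp_iff]
    refine and_congr (forall_congr' h1) ⟨fun h r c => ?_, fun h p hp => ?_⟩
    · obtain ⟨p, hp, hpr⟩ := hm' r c
      rw [← h2, ← hpr]
      exact h p hp
    · obtain ⟨-, r, c, hpr⟩ := hm p hp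
      rw [hpr, h2]
      exact h r c
  constructor
  · rintro ⟨x, hx⟩
    exact ⟨_, (key x).1 hx⟩
  · rintro ⟨X, hX⟩
    refine ⟨fun k => X (finProdFinEquiv.symm k).1 (finProdFinEquiv.symm k).2, (key _).2 ?_⟩
    have h : mat (fun k => X (finProdFinEquiv.symm k).1 (finProdFinEquiv.symm k).2) = X := by
      ext i j
      change X (finProdFinEquiv.symm (finProdFinEquiv (i, j))).1
        (finProdFinEquiv.symm (finProdFinEquiv (i, j))).2 = X i j
      rw [Equiv.symm_apply_apply]
    rw [h]
    exact hX

theorem ARMInstance.isPolyTimeReduction_sentence :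
    IsPolyTimeReduction (ARM 3) ETR ARMInstance.sentence := by
  refine ⟨ARMInstance.polyTime_sentence, fun I => ?_⟩
  change (∃ X, I.IsSolution 3 X) ↔ I.sentence.IsTrue
  rcases Nat.eq_zero_or_pos I.q with hq | hq
  -- Without constraints the zero matrix is a solution, matching the trivially true sentence.
  · refine iff_of_true ⟨0, fun l => (hq ▸ l).elim0, by simp⟩ ?_
    rw [show I.sentence = ⟨0, QFFormula.allZero []⟩ from if_pos hq]
    exact ⟨fun _ => 0, (QFFormula.holds_allZero _ _).2 (by simp)⟩
  · exact (I.isDeterminantalSentence_sentence hq).isTrue_iff.symm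

theorem mainTheorem4 :
    InExistsR (ARM 3) ∧
      ∃ f : ARMInstance → ETRSentence,
        IsPolyTimeReduction (ARM 3) ETR f ∧
          ∀ I : ARMInstance, 0 < I.q → I.IsDeterminantalSentence (f I) :=
  ⟨⟨_, ARMInstance.isPolyTimeReduction_sentence⟩, _, ARMInstance.isPolyTimeReduction_sentence,
    fun I hq => I.isDeterminantalSentence_sentence hq⟩
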